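/- All graphs are finite and simple. For a graph $G$ let $\sigma_2(G)$ be the minimum of $d_G(x)+d_G(y)$ over all pairs of distinct non-adjacent vertices $x,y$ (with $\sigma_2(G)=+\infty$ if $G$ is complete). An $(s,t)$-bipartite-hole in $G$ consists of two disjoint vertex sets $S,T$ with $|S|=s$, $|T|=t$ and no edge of $G$ between $S$ and $T$; the bipartite-hole-number $\widetilde{\alpha}(G)$ is the minimum $k$ for which there are positive integers $s,t$ with $s+t=k+1$ such that $G$ has no $(s,t)$-bipartite-hole. The join $G\vee H$ is the disjoint union of $G$ and $H$ together with all edges between $V(G)$ and $V(H)$, and $mK_1$ is the edgeless graph on $m$ vertices. A graph is traceable if it has a Hamilton path. Theorem. Let $G$ be a connected graph of order $n$ with $\sigma_2(G)\ge 2\widetilde{\alpha}(G)-4$. Then $G$ is traceable, unless $n\ge 4$ is even and $G$ is isomorphic to $G_{\frac{n-2}{2}}\vee \frac{n+2}{2}K_1$ for some graph $G_{\frac{n-2}{2}}$ of order $\frac{n-2}{2}$; in this exceptional case $G$ is not traceable. -/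

import Mathlib

namespace BipartiteHole

/-- An `(s,t)`-bipartite-hole in `G`: disjoint vertex sets `S`, `T` of sizes `s`, `t`
with no edge of `G` between them. -/
def HasBipartiteHole {V : Type*} (G : SimpleGraph V) (s t : ℕ) : Prop :=
  ∃ S T : Finset V, Disjoint S T ∧ S.card = s ∧ T.card = t ∧ ∀ x ∈ S, ∀ y ∈ T, ¬ G.Adj x y

/-- The bipartite-hole-number: the least `k` such that for some positive `s`, `t` with
`s + t = k + 1` the graph has no `(s,t)`-bipartite-hole.  (For a finite graph the set is non-empty:
see `bipartiteHoleNumber_set_nonempty`.) -/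
noncomputable def bipartiteHoleNumber {V : Type*} (G : SimpleGraph V) : ℕ :=
  sInf {k : ℕ | ∃ s t : ℕ, 0 < s ∧ 0 < t ∧ s + t = k + 1 ∧ ¬ HasBipartiteHole G s t}

theorem bipartiteHoleNumber_set_nonempty {V : Type*} [Fintype V] (G : SimpleGraph V) :
    {k : ℕ | ∃ s t : ℕ, 0 < s ∧ 0 < t ∧ s + t = k + 1 ∧ ¬ HasBipartiteHole G s t}.Nonempty := by
  refine ⟨Fintype.card V + 1, 1, Fintype.card V + 1, by omega, by omega, by omega, ?_⟩
  rintro ⟨S, T, -, -, hT, -⟩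
  have := T.card_le_univ
  omega

/-- `σ₂(G)`: the minimum of `d(x) + d(y)` over pairs of distinct non-adjacent vertices; it is `⊤`
when there is no such pair, that is, when `G` is complete. -/
noncomputable def sigmaTwo {V : Type*} [Fintype V] (G : SimpleGraph V) [DecidableRel G.Adj] : ℕ∞ :=
  ⨅ (x : V) (y : V) (_ : x ≠ y) (_ : ¬ G.Adj x y), ((G.degree x + G.degree y : ℕ) : ℕ∞)

/-- A graph is traceable if it has a Hamilton path. -/
def IsTraceable {V : Type*} [DecidableEq V] (G : SimpleGraph V) : Prop :=
  ∃ (a b : V) (p : G.Walk a b), p.IsHamiltonian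

/-- The join of two graphs: their disjoint sum together with all edges between them. -/
def join {V W : Type*} (G : SimpleGraph V) (H : SimpleGraph W) : SimpleGraph (V ⊕ W) :=
  SimpleGraph.sum G H ⊔ completeBipartiteGraph V W

end BipartiteHole

/-! Choose `s ≤ t` with `s + t` one more than the bipartite-hole-number and no `(s,t)`-hole. If `G`
has no Hamilton path, pass to an edge-maximal supergraph without one. Degrees only grow and no holes
appear, and by maximality any two non-adjacent vertices are ends of two disjoint paths covering the
graph (`Counterexample`).

The cone over a non-traceable graph has no Hamilton cycle, and two covering paths joined through the
apex form a Hamilton path of the cone. Counting rotations of that path against the missing hole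
(`NonHamPath.card_le_and`) bounds the degrees of its ends. Among covers by two disjoint paths take
one with the first vertex set `S` largest: the degree condition now forces all ends to have degree
exactly `s + t - 3`, and the equality case makes the complement of `S` a clique (`degree_ends`,
`adj_compl`). Further holes and reroutings shrink the complement to one vertex.

What remains is a path `1, …, p` into which a vertex `0` cannot be inserted (`InsConf`). Successors
of neighbours of `0`, with `1` added, are independent, and a vertex that is neither such a successor
nor a neighbour of `0` would need too many neighbours among them. So the two kinds alternate
(`length_eq`), and the successors together with `0` form an independent set `I` with `2|I| = n + 2`
and `|I|` equal to the bipartite-hole-number. In the original `G` a vertex of `I` has degree at most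
`|I| - 2`; the degree condition forces equality, hence the join structure. Conversely, such a join
has an independent set too large for a Hamilton path. -/

namespace BipartiteHole

/-! ### Paths with a prescribed vertex set. -/

section

/-- `PathOn G S a b`: the graph `G` has a path from `a` to `b` whose vertex set is exactly `S`. -/
inductive PathOn {V : Type*} (G : SimpleGraph V) : Set V → V → V → Prop
  | single (a : V) : PathOn G {a} a a
  | cons {a b c : V} {S : Set V} (ha : a ∉ S) (hab : G.Adj a b) (h : PathOn G S b c) :
      PathOn G (insert a S) a c

namespace PathOn

variable {V W : Type*} {G H : SimpleGraph V} {S T : Set V} {a b c d : V}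

theorem start_mem (h : PathOn G S a b) : a ∈ S := by
  cases h <;> simp

theorem end_mem (h : PathOn G S a b) : b ∈ S := by
  induction h with
  | single a => simp
  | cons _ _ _ ih => exact Set.mem_insert_of_mem _ ih

theorem finite (h : PathOn G S a b) : S.Finite := by
  induction h with
  | single a => exact Set.finite_singleton a
  | cons _ _ _ ih => exact ih.insert _

theorem of_eq (h : PathOn G S a b) (e : S = T) : PathOn G T a b := e ▸ h

theorem mono (hGH : G ≤ H) (h : PathOn G S a b) : PathOn H S a b := by
  induction h with
  | single a => exact single a
  | cons ha hab _ ih => exact cons ha (hGH hab) ih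

theorem append (h : PathOn G S a b) (hbc : G.Adj b c) (h' : PathOn G T c d)
    (hST : Disjoint S T) : PathOn G (S ∪ T) a d := by
  induction h with
  | single a =>
    rw [Set.singleton_union]
    exact cons (Set.disjoint_singleton_left.1 hST) hbc h'
  | @cons x y z S hx hxy _ ih =>
    rw [Set.insert_union]
    rw [Set.disjoint_insert_left] at hST
    exact cons (by simp [hx, hST.1]) hxy (ih hbc hST.2)

theorem symm (h : PathOn G S a b) : PathOn G S b a := by
  induction h with
  | single a => exact single a
  | @cons x y z S hx hxy _ ih =>
    exact (ih.append hxy.symm (single x) (Set.disjoint_singleton_right.2 hx)).of_eq (by simp)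

theorem map {K : SimpleGraph W} (f : V → W) (h : PathOn G S a b)
    (hf : ∀ x ∈ S, ∀ y ∈ S, G.Adj x y → K.Adj (f x) (f y)) (hinj : Set.InjOn f S) :
    PathOn K (f '' S) (f a) (f b) := by
  induction h with
  | single a => simpa using single (f a)
  | @cons x y z S hx hxy h ih =>
    rw [Set.image_insert_eq]
    refine cons ?_ (hf _ (Set.mem_insert _ _) _ (Set.mem_insert_of_mem _ h.start_mem) hxy)
      (ih (fun u hu w hw => hf u (Set.mem_insert_of_mem _ hu) w (Set.mem_insert_of_mem _ hw))
        (hinj.mono (Set.subset_insert _ _)))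
    rintro ⟨u, hu, hux⟩
    have := hinj (Set.mem_insert_of_mem _ hu) (Set.mem_insert _ _) hux
    exact hx (this ▸ hu)

theorem of_comap {K : SimpleGraph W} {f : V → W} (h : PathOn (K.comap f) S a b)
    (hinj : Set.InjOn f S) : PathOn K (f '' S) (f a) (f b) :=
  h.map f (fun _ _ _ _ e => e) hinj

/-- A path can be cut in front of any vertex other than its first. -/
theorem split (h : PathOn G S a b) (hc : c ∈ S) (hca : c ≠ a) :
    ∃ S₁ S₂ e, PathOn G S₁ a e ∧ G.Adj e c ∧ PathOn G S₂ c b ∧ Disjoint S₁ S₂ ∧ S₁ ∪ S₂ = S := by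
  induction h with
  | single a => exact absurd hc hca
  | @cons x y z S hx hxy h ih =>
    have hc' : c ∈ S := by simpa [hca] using hc
    by_cases hcy : c = y
    · subst hcy
      exact ⟨{x}, S, x, single x, hxy, h, Set.disjoint_singleton_left.2 hx, Set.singleton_union⟩
    · obtain ⟨S₁, S₂, e, h1, he, h2, hd, hu⟩ := ih hc' hcy
      refine ⟨insert x S₁, S₂, e, cons (fun hx1 => hx (hu ▸ Or.inl hx1)) hxy h1, he, h2, ?_, ?_⟩
      · rw [Set.disjoint_insert_left]
        exact ⟨fun hx2 => hx (hu ▸ Or.inr hx2), hd⟩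
      · rw [Set.insert_union, hu]

/-- Removing the first vertex of a path leaves nothing or a path. -/
theorem diff_start (h : PathOn G S a b) :
    S \ {a} = ∅ ∨ ∃ c, G.Adj a c ∧ PathOn G (S \ {a}) c b := by
  cases h with
  | single a => left; simp
  | @cons _ y _ S hx hxy h =>
    right
    exact ⟨y, hxy, h.of_eq (by rw [Set.insert_sdiff_of_mem _ (Set.mem_singleton a),
      Set.sdiff_singleton_eq_self hx])⟩

/-- A vertex set which carries a closed path carries a path ending in any given vertex. -/
theorem rotate (h : PathOn G S a b) (hab : a = b ∨ G.Adj a b) (hc : c ∈ S) :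
    ∃ d, PathOn G S d c := by
  by_cases hca : c = a
  · exact ⟨b, hca ▸ h.symm⟩
  · obtain ⟨S₁, S₂, e, h1, he, h2, hd, hu⟩ := h.split hc hca
    rcases hab with hab | hab
    · subst hab
      exact absurd h2.end_mem (Set.disjoint_left.1 hd h1.start_mem)
    · exact ⟨e, (h1.symm.append hab h2.symm hd).of_eq hu⟩

/-- A path uses the new edge at most once, so deleting that edge leaves two paths. This turns
edge-maximality into covers by two paths. -/
theorem of_sup_edge {x y : V} (h : PathOn (G ⊔ SimpleGraph.edge x y) S a b) :
    PathOn G S a b ∨ ∃ S₁ S₂, Disjoint S₁ S₂ ∧ S₁ ∪ S₂ = S ∧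
      (PathOn G S₁ a x ∧ PathOn G S₂ y b ∨ PathOn G S₁ a y ∧ PathOn G S₂ x b) := by
  induction h with
  | single a => exact Or.inl (single a)
  | @cons u w z S hu huw h ih =>
    rw [SimpleGraph.sup_adj, SimpleGraph.edge_adj] at huw
    rcases ih with ih | ⟨S₁, S₂, hd, hS, ih⟩
    · rcases huw with huw | ⟨⟨rfl, rfl⟩ | ⟨rfl, rfl⟩, -⟩
      · exact Or.inl (cons hu huw ih)
      · exact Or.inr ⟨{u}, S, by simpa using hu, by simp, Or.inl ⟨single _, ih⟩⟩
      · exact Or.inr ⟨{u}, S, by simpa using hu, by simp, Or.inr ⟨single _, ih⟩⟩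
    · have hu1 : u ∉ S₁ := fun h => hu (hS ▸ Or.inl h)
      have hu2 : u ∉ S₂ := fun h => hu (hS ▸ Or.inr h)
      rcases huw with huw | ⟨huw, -⟩
      · refine Or.inr ⟨insert u S₁, S₂, by simp [hd, hu2], by rw [Set.insert_union, hS], ?_⟩
        rcases ih with ⟨h1, h2⟩ | ⟨h1, h2⟩
        · exact Or.inl ⟨cons hu1 huw h1, h2⟩
        · exact Or.inr ⟨cons hu1 huw h1, h2⟩
      · exfalso
        rcases ih with ⟨h1, h2⟩ | ⟨h1, h2⟩ <;> rcases huw with ⟨rfl, rfl⟩ | ⟨rfl, rfl⟩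
        · exact hu1 h1.end_mem
        · exact hu2 h2.start_mem
        · exact hu2 h2.start_mem
        · exact hu1 h1.end_mem

/-- Reroutings become statements about intervals of integers. Starting at `1` keeps the index `0`
free for a vertex off the path. -/
theorem enumerate (h : PathOn G S a b) : ∃ (m : ℕ) (v : ℕ → V), 1 ≤ m ∧
    Set.InjOn v (Set.Icc 1 m) ∧ v '' Set.Icc 1 m = S ∧ v 1 = a ∧ v m = b ∧
    ∀ i, 1 ≤ i → i < m → G.Adj (v i) (v (i + 1)) := by
  induction h with
  | single a => exact ⟨1, fun _ => a, le_rfl, by simp, by simp, rfl, rfl, by omega⟩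
  | @cons u w z S hu huw h ih =>
    obtain ⟨m, v, hm, hinj, him, h1, hmz, hadj⟩ := ih
    have hmem : ∀ i, 1 ≤ i → i ≤ m → v i ∈ S := fun i h1 h2 => him ▸ ⟨i, ⟨h1, h2⟩, rfl⟩
    refine ⟨m + 1, fun i => if i ≤ 1 then u else v (i - 1), by omega, ?_, ?_, by simp, ?_, ?_⟩
    · intro i hi j hj hij
      simp only [Set.mem_Icc] at hi hj
      by_cases hi1 : i ≤ 1 <;> by_cases hj1 : j ≤ 1 <;> simp only [hi1, hj1, if_true, if_false] at hij
      · omega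
      · exact absurd (hij ▸ hmem (j - 1) (by omega) (by omega)) hu
      · exact absurd (hij ▸ hmem (i - 1) (by omega) (by omega)) hu
      · have := @hinj (i - 1) ⟨by omega, by omega⟩ (j - 1) ⟨by omega, by omega⟩ hij
        omega
    · ext x
      simp only [Set.mem_image, Set.mem_Icc, Set.mem_insert_iff]
      constructor
      · rintro ⟨i, hi, rfl⟩
        by_cases hi1 : i ≤ 1
        · simp [hi1]
        · simp only [hi1, if_false]
          exact Or.inr (hmem _ (by omega) (by omega))
      · rintro (rfl | hx)
        · exact ⟨1, by omega, by simp⟩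
        · rw [← him] at hx
          obtain ⟨i, hi, rfl⟩ := hx
          simp only [Set.mem_Icc] at hi
          exact ⟨i + 1, by omega, by simp [show ¬ (i + 1 ≤ 1) by omega]⟩
    · simp [show ¬ (m + 1 ≤ 1) by omega, hmz]
    · intro i hi1 him'
      by_cases hi2 : i ≤ 1
      · obtain rfl : i = 1 := by omega
        simpa [h1] using huw
      · have := hadj (i - 1) (by omega) (by omega)
        rw [show i - 1 + 1 = i by omega] at this
        simpa [hi2, show ¬ (i + 1 ≤ 1) by omega] using this

theorem seg {K : SimpleGraph ℕ} {i j : ℕ} (hij : i ≤ j)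
    (h : ∀ l, i ≤ l → l < j → K.Adj l (l + 1)) : PathOn K (Set.Icc i j) i j := by
  induction j, hij using Nat.le_induction with
  | base => simpa using single i
  | succ j hij ih =>
    refine ((ih fun l h1 h2 => h l h1 (by omega)).append (h j hij (by omega)) (single (j + 1))
      (by simp)).of_eq ?_
    ext x; simp; omega

theorem exists_of_clique (hS : S.Finite) (hne : S.Nonempty)
    (h : ∀ x ∈ S, ∀ y ∈ S, x ≠ y → G.Adj x y) : ∃ a b, PathOn G S a b := by
  induction S, hS using Set.Finite.induction_on with
  | empty => simp at hne
  | @insert x S hx _ ih =>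
    rcases S.eq_empty_or_nonempty with rfl | hne'
    · exact ⟨x, x, by simpa using single x⟩
    · obtain ⟨a, b, hab⟩ := ih hne' fun y hy z hz =>
        h y (Set.mem_insert_of_mem _ hy) z (Set.mem_insert_of_mem _ hz)
      exact ⟨x, b, cons hx (h x (Set.mem_insert _ _) a (Set.mem_insert_of_mem _ hab.start_mem)
        (fun e => hx (e ▸ hab.start_mem))) hab⟩

/-- No two consecutive vertices lie in `I`. The sharper bound for paths starting outside `I` is what
the induction needs when a vertex of `I` is prepended. -/
theorem two_mul_ncard_indep_le {I : Set V} (hI : ∀ x ∈ I, ∀ y ∈ I, ¬ G.Adj x y)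
    (h : PathOn G S a b) :
    2 * (S ∩ I).ncard ≤ S.ncard + 1 ∧ (a ∉ I → 2 * (S ∩ I).ncard ≤ S.ncard) := by
  induction h with
  | single a =>
    by_cases ha : a ∈ I
    · simp [Set.inter_eq_left.2 (Set.singleton_subset_iff.2 ha), ha]
    · simp [Set.singleton_inter_eq_empty.2 ha]
  | @cons u w z S hu huw h ih =>
    have hf := h.finite
    rw [Set.ncard_insert_of_notMem hu hf]
    by_cases huI : u ∈ I
    · have hw : w ∉ I := fun hw => hI u huI w hw huw
      rw [Set.insert_inter_of_mem huI, Set.ncard_insert_of_notMem (fun h => hu h.1)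
        (hf.inter_of_left _)]
      have := ih.2 hw
      exact ⟨by omega, fun h => absurd huI h⟩
    · rw [Set.insert_inter_of_notMem huI]
      have := ih.1
      exact ⟨by omega, fun _ => by omega⟩

theorem exists_walk (h : PathOn G S a b) :
    ∃ p : G.Walk a b, p.IsPath ∧ ∀ x, x ∈ p.support ↔ x ∈ S := by
  induction h with
  | single a => exact ⟨.nil, .nil, by simp⟩
  | @cons u w z S hu huw h ih =>
    obtain ⟨p, hp, hs⟩ := ih
    exact ⟨.cons huw p, hp.cons (by rwa [hs]), by simp [hs]⟩

theorem of_walk (p : G.Walk a b) (hp : p.IsPath) : PathOn G {x | x ∈ p.support} a b := by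
  induction p with
  | nil => simpa using single _
  | @cons u v w h p ih =>
    rw [SimpleGraph.Walk.cons_isPath_iff] at hp
    refine (cons (S := {x | x ∈ p.support}) hp.2 h (ih hp.1)).of_eq ?_
    ext x; simp

end PathOn

theorem isTraceable_iff {V : Type*} [DecidableEq V] {G : SimpleGraph V} :
    IsTraceable G ↔ ∃ a b, PathOn G Set.univ a b := by
  constructor
  · rintro ⟨a, b, p, hp⟩
    refine ⟨a, b, (PathOn.of_walk p hp.isPath).of_eq ?_⟩
    ext x; simpa using hp.mem_support x
  · rintro ⟨a, b, h⟩
    obtain ⟨p, hp, hs⟩ := h.exists_walk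
    exact ⟨a, b, p, hp.isHamiltonian_of_mem fun x => (hs x).2 trivial⟩

end

end BipartiteHole

/-! ### Counting rotations of a Hamilton path when holes and Hamilton cycles are absent. -/

namespace BipartiteHole

section

theorem exists_mem_card_filter_le_eq (A : Finset ℕ) {s : ℕ} (hs : 1 ≤ s) (hsA : s ≤ A.card) :
    ∃ i ∈ A, (A.filter (· ≤ i)).card = s := by
  induction A using Finset.induction_on_max with
  | empty => simp at hsA; omega
  | insert a A ha ih =>
    have haA : a ∉ A := fun h => lt_irrefl _ (ha a h)
    rw [Finset.card_insert_of_notMem haA] at hsA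
    by_cases h : s ≤ A.card
    · obtain ⟨i, hi, hc⟩ := ih h
      refine ⟨i, Finset.mem_insert_of_mem hi, ?_⟩
      rw [Finset.filter_insert, if_neg (by have := ha i hi; omega), hc]
    · refine ⟨a, Finset.mem_insert_self _ _, ?_⟩
      rw [Finset.filter_true_of_mem, Finset.card_insert_of_notMem haA]
      · omega
      · intro x hx
        rcases Finset.mem_insert.1 hx with rfl | hx
        · exact le_rfl
        · exact (ha x hx).le

/-- No two disjoint sets of sizes at least `s` and `t` inside `U` are free of edges between them. -/
def HoleFreeOn {V : Type*} (G : SimpleGraph V) (U : Finset V) (s t : ℕ) : Prop :=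
  ∀ X Y : Finset V, X ⊆ U → Y ⊆ U → Disjoint X Y → (∀ x ∈ X, ∀ y ∈ Y, ¬ G.Adj x y) →
    s ≤ X.card → Y.card < t

theorem HoleFreeOn.symm {V : Type*} {G : SimpleGraph V} {U : Finset V} {s t : ℕ}
    (h : HoleFreeOn G U s t) : HoleFreeOn G U t s := by
  intro X Y hX hY hd hn hc
  by_contra hY'
  have := h Y X hY hX hd.symm (fun x hx y hy e => hn y hy x hx e.symm) (by omega)
  omega

theorem HoleFreeOn.comap {V W : Type*} {G : SimpleGraph V} {U : Finset V} {s t : ℕ}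
    (h : HoleFreeOn G U s t) {f : W → V} {U' : Finset W} (hf : Set.MapsTo f U' U)
    (hinj : Set.InjOn f U') : HoleFreeOn (G.comap f) U' s t := by
  classical
  intro X Y hX hY hd hn hc
  rw [← Finset.card_image_of_injOn (hinj.mono hX)] at hc
  rw [← Finset.card_image_of_injOn (hinj.mono hY)]
  refine h (X.image f) (Y.image f) ?_ ?_ ?_ ?_ hc
  · intro x hx
    obtain ⟨i, hi, rfl⟩ := Finset.mem_image.1 hx
    exact hf (hX hi)
  · intro x hx
    obtain ⟨i, hi, rfl⟩ := Finset.mem_image.1 hx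
    exact hf (hY hi)
  · rw [Finset.disjoint_left]
    intro x hx hy
    obtain ⟨i, hi, rfl⟩ := Finset.mem_image.1 hx
    obtain ⟨j, hj, hij⟩ := Finset.mem_image.1 hy
    exact Finset.disjoint_left.1 hd hi (hinj (hY hj) (hX hi) hij ▸ hj)
  · intro x hx y hy
    obtain ⟨i, hi, rfl⟩ := Finset.mem_image.1 hx
    obtain ⟨j, hj, rfl⟩ := Finset.mem_image.1 hy
    exact hn i hi j hj

/-- In a graph without `(s,t)`-holes, a vertex `w` outside an independent set `J` has at least `t`
neighbours in `J` as soon as a suitable set `P` sees neither `J` nor `w`. -/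
theorem HoleFreeOn.le_card_filter_adj {V : Type*} [DecidableEq V] {G : SimpleGraph V}
    [DecidableRel G.Adj] {U : Finset V} {s t : ℕ} (h : HoleFreeOn G U s t) {J P : Finset V} {w : V}
    (hJU : J ⊆ U) (hPU : P ⊆ U) (hwU : w ∈ U) (hJ : ∀ x ∈ J, ∀ y ∈ J, ¬ G.Adj x y)
    (hwJ : w ∉ J) (hwP : w ∉ P) (hJP : Disjoint J P) (hadjw : ∀ x ∈ P, ¬ G.Adj w x)
    (hadj : ∀ x ∈ J, ∀ y ∈ P, ¬ G.Adj x y) (hcard : s + t ≤ J.card + P.card + 1)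
    (hP : P.card ≤ s) : t ≤ (J.filter (G.Adj w)).card := by
  by_contra hlt
  have hcw : (insert w J).card = J.card + 1 := Finset.card_insert_of_notMem hwJ
  -- `X` has `t` elements: `w`, all its neighbours in `J`, and padding from `J`. The rest of `J`
  -- together with `P` sees nothing of `X` and has at least `s` elements.
  obtain ⟨X, hX0, hX1, hXc⟩ := Finset.exists_subsuperset_card_eq (n := t)
    (Finset.insert_subset_insert w (Finset.filter_subset (G.Adj w) J))
    ((Finset.card_insert_le _ _).trans (by omega)) (by omega)
  have hdX : Disjoint X P := Finset.disjoint_of_subset_left hX1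
    (Finset.disjoint_insert_left.2 ⟨hwP, hJP⟩)
  have hU : insert w J ⊆ U := Finset.insert_subset hwU hJU
  have hY : ((insert w J \ X) ∪ P).card = J.card + 1 - t + P.card := by
    rw [Finset.card_union_of_disjoint, Finset.card_sdiff_of_subset hX1, hcw, hXc]
    exact Finset.disjoint_of_subset_left Finset.sdiff_subset
      (Finset.disjoint_insert_left.2 ⟨hwP, hJP⟩)
  have hwX : w ∈ X := hX0 (Finset.mem_insert_self _ _)
  have := h.symm X ((insert w J \ X) ∪ P) (hX1.trans hU)
    (Finset.union_subset (Finset.sdiff_subset.trans hU) hPU)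
    (Finset.disjoint_union_right.2 ⟨Finset.disjoint_sdiff, hdX⟩) ?_ (by omega)
  · omega
  · intro x hx y hy
    rcases Finset.mem_union.1 hy with hy' | hy'
    · obtain ⟨hy1, hy2⟩ := Finset.mem_sdiff.1 hy'
      have hyJ : y ∈ J := (Finset.mem_insert.1 hy1).resolve_left (fun e => hy2 (e ▸ hwX))
      rcases Finset.mem_insert.1 (hX1 hx) with rfl | hxJ
      · exact fun e => hy2 (hX0 (Finset.mem_insert_of_mem (Finset.mem_filter.2 ⟨hyJ, e⟩)))
      · exact hJ x hxJ y hyJ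
    · rcases Finset.mem_insert.1 (hX1 hx) with rfl | hxJ
      · exact hadjw y hy'
      · exact hadj x hxJ y hy'

section HamiltonianPath

variable {K : SimpleGraph ℕ} {N : ℕ}

/-- The path `1, …, N` is a Hamilton path of `K` on `{1, …, N}`, which has no Hamilton cycle. -/
structure NonHamPath (K : SimpleGraph ℕ) (N : ℕ) : Prop where
  adj : ∀ i, 1 ≤ i → i < N → K.Adj i (i + 1)
  not_adj : ∀ a b, PathOn K (Set.Icc 1 N) a b → ¬ K.Adj a b

namespace NonHamPath

theorem seg (h : NonHamPath K N) {i j : ℕ} (hi : 1 ≤ i) (hij : i ≤ j) (hj : j ≤ N) :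
    PathOn K (Set.Icc i j) i j :=
  PathOn.seg hij fun l h1 h2 => h.adj l (by omega) (by omega)

theorem not_adj_ends (h : NonHamPath K N) (hN : 1 ≤ N) : ¬ K.Adj 1 N :=
  h.not_adj _ _ (h.seg le_rfl hN le_rfl)

/-- Otherwise `a-1, …, 1, a, …, b, N, …, b+1` closes to a Hamilton cycle. -/
theorem not_adj_pred_succ (h : NonHamPath K N) {a b : ℕ} (ha : 1 < a) (hab : a ≤ b) (hb : b < N)
    (h1 : K.Adj 1 a) (hN : K.Adj N b) : ¬ K.Adj (a - 1) (b + 1) := by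
  refine h.not_adj _ _ (((((h.seg le_rfl (show 1 ≤ a - 1 by omega) (by omega)).symm.append h1
    (h.seg (by omega) hab (by omega)) ?_).append hN.symm
    (h.seg (by omega) (show b + 1 ≤ N by omega) le_rfl).symm ?_)).of_eq ?_)
  · rw [Set.disjoint_left]; simp; omega
  · rw [Set.disjoint_left]; simp; omega
  · ext x; simp; omega

/-- Otherwise `b+1, …, a, 1, …, b, N, …, a+1` closes to a Hamilton cycle. -/
theorem not_adj_succ_succ (h : NonHamPath K N) {a b : ℕ} (hb : 1 ≤ b) (hba : b < a) (ha : a < N)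
    (h1 : K.Adj 1 a) (hN : K.Adj N b) : ¬ K.Adj (b + 1) (a + 1) := by
  refine h.not_adj _ _ (((((h.seg (by omega) (show b + 1 ≤ a by omega) (by omega)).append h1.symm
    (h.seg le_rfl hb (by omega)) ?_).append hN.symm
    (h.seg (by omega) (show a + 1 ≤ N by omega) le_rfl).symm ?_)).of_eq ?_)
  · rw [Set.disjoint_left]; simp; omega
  · rw [Set.disjoint_left]; simp; omega
  · ext x; simp; omega

/-- The counting step for a Hamilton path in a graph without Hamilton cycles and without
`(s,t)`-holes: the degrees of the ends are bounded, and in the tight case every vertex that sees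
none of the rotated starting vertices follows a neighbour of the last vertex. -/
theorem card_le_and [DecidableRel K.Adj] (h : NonHamPath K N) {s t : ℕ}
    (hole : HoleFreeOn K (Finset.Icc 1 N) s t) (hs : 1 ≤ s)
    (hsA : s ≤ ((Finset.Icc 1 N).filter (K.Adj 1)).card)
    (hA : s + t ≤ ((Finset.Icc 1 N).filter (K.Adj 1)).card + 2) :
    ((Finset.Icc 1 N).filter (K.Adj N)).card + 2 ≤ s + t ∧
    (((Finset.Icc 1 N).filter (K.Adj N)).card + 2 = s + t → ∀ w ∈ Finset.Icc 1 N,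
      (∀ a ∈ Finset.Icc 1 N, K.Adj 1 a → a - 1 ≠ w ∧ ¬ K.Adj (a - 1) w) →
      1 < w ∧ K.Adj N (w - 1)) := by
  set A := (Finset.Icc 1 N).filter (K.Adj 1) with hAdef
  set B := (Finset.Icc 1 N).filter (K.Adj N) with hBdef
  -- The threshold `i` is the `s`-th neighbour of `1`. One hole bounds the neighbours of `N` from
  -- `i` on by `t - 1`, another those below `i` by `s - 1`.
  obtain ⟨i, hiA, hi⟩ := exists_mem_card_filter_le_eq A hs hsA
  have hN : 1 ≤ N := by
    have := (Finset.mem_Icc.1 (Finset.mem_filter.1 hiA).1); omega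
  have h1N := h.not_adj_ends hN
  have memA : ∀ a ∈ A, 1 < a ∧ a < N ∧ K.Adj 1 a := by
    intro a ha
    obtain ⟨ha1, ha2⟩ := Finset.mem_filter.1 ha
    rw [Finset.mem_Icc] at ha1
    have h1 : a ≠ 1 := fun e => K.loopless.irrefl _ (e ▸ ha2)
    have h2 : a ≠ N := fun e => h1N (e ▸ ha2)
    exact ⟨by omega, by omega, ha2⟩
  have memB : ∀ b ∈ B, 1 < b ∧ b < N ∧ K.Adj N b := by
    intro a ha
    obtain ⟨ha1, ha2⟩ := Finset.mem_filter.1 ha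
    rw [Finset.mem_Icc] at ha1
    have h1 : a ≠ N := fun e => K.loopless.irrefl _ (e ▸ ha2)
    have h2 : a ≠ 1 := fun e => h1N ((e ▸ ha2).symm)
    exact ⟨by omega, by omega, ha2⟩
  have succ_inj : Function.Injective (fun b : ℕ => b + 1) := fun x y h => by simpa using h
  have hiA' := memA i hiA
  have cA : (A.filter (· ≤ i)).card + (A.filter (¬ · ≤ i)).card = A.card :=
    Finset.card_filter_add_card_filter_not _
  have cB : (B.filter (i ≤ ·)).card + (B.filter (¬ i ≤ ·)).card = B.card :=
    Finset.card_filter_add_card_filter_not _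
  -- the rotated starting vertices up to the threshold
  set X := (A.filter (· ≤ i)).image (· - 1) with hX
  have hXc : X.card = s := by
    rw [hX, Finset.card_image_of_injOn, hi]
    intro x hx y hy hxy
    have := memA x (Finset.mem_filter.1 hx).1
    have := memA y (Finset.mem_filter.1 hy).1
    simp only at hxy
    omega
  have memX : ∀ x ∈ X, x + 1 ∈ A ∧ x + 1 ≤ i := by
    intro x hx
    obtain ⟨a, ha, rfl⟩ := Finset.mem_image.1 hx
    obtain ⟨ha, hai⟩ := Finset.mem_filter.1 ha
    have := memA a ha
    rw [show a - 1 + 1 = a by omega]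
    exact ⟨ha, hai⟩
  set Y := (B.filter (i ≤ ·)).image (· + 1) with hY
  have hYc : Y.card = (B.filter (i ≤ ·)).card := Finset.card_image_of_injective _ succ_inj
  have memY : ∀ y ∈ Y, y - 1 ∈ B ∧ i ≤ y - 1 := by
    intro x hx
    obtain ⟨a, ha, rfl⟩ := Finset.mem_image.1 hx
    exact Finset.mem_filter.1 ha
  have hXU : X ⊆ Finset.Icc 1 N := by
    intro x hx
    have := memA _ (memX x hx).1
    rw [Finset.mem_Icc]; omega
  have hYU : Y ⊆ Finset.Icc 1 N := by
    intro y hy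
    have := memB _ (memY y hy).1
    rw [Finset.mem_Icc]; omega
  have hXY : Disjoint X Y := by
    rw [Finset.disjoint_left]
    intro x hx hy
    have := memX x hx
    have := memY x hy
    have := memB _ this.1
    omega
  have hXYadj : ∀ x ∈ X, ∀ y ∈ Y, ¬ K.Adj x y := by
    intro x hx y hy
    obtain ⟨hx1, hx2⟩ := memX x hx
    obtain ⟨hy1, hy2⟩ := memY y hy
    have ha := memA _ hx1
    have hb := memB _ hy1
    have := h.not_adj_pred_succ ha.1 (by omega) hb.2.1 ha.2.2 hb.2.2
    rwa [show x + 1 - 1 = x by omega, show y - 1 + 1 = y by omega] at this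
  have hY_lt : Y.card < t := hole X Y hXU hYU hXY hXYadj hXc.ge
  -- the neighbours of the last vertex below the threshold
  have hlow : (B.filter (¬ i ≤ ·)).card < s := by
    set X' := (B.filter (¬ i ≤ ·)).image (· + 1) with hX'
    have hX'c : X'.card = (B.filter (¬ i ≤ ·)).card := Finset.card_image_of_injective _ succ_inj
    -- The neighbour `i` counts on both sides of the threshold, and the vertex `1` adds one more, so
    -- `Y'` has `|A| - s + 2 ≥ t` elements.
    set Y' := insert 1 ((A.filter (i ≤ ·)).image (· + 1)) with hY'
    have memX' : ∀ y ∈ X', y - 1 ∈ B ∧ y - 1 < i := by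
      intro x hx
      obtain ⟨a, ha, rfl⟩ := Finset.mem_image.1 hx
      obtain ⟨ha, hai⟩ := Finset.mem_filter.1 ha
      exact ⟨ha, by simpa using hai⟩
    have memY' : ∀ y ∈ Y', y = 1 ∨ y - 1 ∈ A ∧ i ≤ y - 1 := by
      intro x hx
      rcases Finset.mem_insert.1 hx with rfl | hx
      · exact Or.inl rfl
      obtain ⟨a, ha, rfl⟩ := Finset.mem_image.1 hx
      exact Or.inr (Finset.mem_filter.1 ha)
    have hY'c : Y'.card = (A.filter (¬ · ≤ i)).card + 2 := by
      rw [hY', Finset.card_insert_of_notMem, Finset.card_image_of_injective _ succ_inj]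
      · have : A.filter (i ≤ ·) = insert i (A.filter (¬ · ≤ i)) := by
          ext x
          simp only [Finset.mem_filter, Finset.mem_insert]
          constructor
          · rintro ⟨h1, h2⟩
            by_cases hx : x = i
            · exact Or.inl hx
            · exact Or.inr ⟨h1, by omega⟩
          · rintro (rfl | ⟨h1, h2⟩)
            · exact ⟨hiA, le_rfl⟩
            · exact ⟨h1, by omega⟩
        rw [this, Finset.card_insert_of_notMem (by simp)]
      · intro hm
        obtain ⟨a, ha, h1⟩ := Finset.mem_image.1 hm
        have := memA a (Finset.mem_filter.1 ha).1
        omega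
    have := hole.symm Y' X' ?_ ?_ ?_ ?_ (by omega)
    · omega
    · intro y hy
      rw [Finset.mem_Icc]
      rcases memY' y hy with rfl | ⟨h1, h2⟩
      · omega
      · have := memA _ h1; omega
    · intro x hx
      have := memB _ (memX' x hx).1
      rw [Finset.mem_Icc]; omega
    · rw [Finset.disjoint_left]
      intro y hy hx
      have h1 := memX' y hx
      have h2 := memB _ h1.1
      rcases memY' y hy with rfl | ⟨h3, h4⟩ <;> omega
    · intro y hy x hx hyx
      obtain ⟨hx1, hx2⟩ := memX' x hx
      have hb := memB _ hx1
      rcases memY' y hy with rfl | ⟨h3, h4⟩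
      · have := h.not_adj_pred_succ (a := 2) (by omega) (show 2 ≤ x - 1 by omega) (by omega)
          (h.adj 1 le_rfl (by omega)) hb.2.2
        rw [show x - 1 + 1 = x by omega] at this
        exact this hyx
      · have ha := memA _ h3
        have := h.not_adj_succ_succ (a := y - 1) (b := x - 1) (by omega) (by omega) (by omega)
          ha.2.2 hb.2.2
        rw [show x - 1 + 1 = x by omega, show y - 1 + 1 = y by omega] at this
        exact this hyx.symm
  refine ⟨by omega, fun hB w hw hwA => ?_⟩
  -- In the tight case `|Y| = t - 1`, so a further vertex unseen by `X` would complete a hole.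
  by_contra hcon
  have hwY : w ∉ Y := by
    intro hwY
    have h1 := memB _ (memY w hwY).1
    exact hcon ⟨by omega, h1.2.2⟩
  have hwX : ∀ x ∈ X, x ≠ w ∧ ¬ K.Adj x w := by
    intro x hx
    have h1 := memX x hx
    exact hwA (x + 1) (Finset.mem_filter.1 h1.1).1 (memA _ h1.1).2.2
  have := hole X (insert w Y) hXU (Finset.insert_subset hw hYU) ?_ ?_ hXc.ge
  · rw [Finset.card_insert_of_notMem hwY] at this
    omega
  · rw [Finset.disjoint_insert_right]
    exact ⟨fun hx => (hwX w hx).1 rfl, hXY⟩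
  · intro x hx y hy
    rcases Finset.mem_insert.1 hy with rfl | hy
    · exact (hwX x hx).2
    · exact hXYadj x hx y hy

end NonHamPath

end HamiltonianPath

end

end BipartiteHole

/-! ### A path into which one further vertex cannot be inserted. -/

namespace BipartiteHole

section

variable {K : SimpleGraph ℕ} {p : ℕ}

/-- `1, …, p` is a path of `K`, and `K` has no path on the vertex set `{0, 1, …, p}`. -/
structure NonInsPath (K : SimpleGraph ℕ) (p : ℕ) : Prop where
  adj : ∀ i, 1 ≤ i → i < p → K.Adj i (i + 1)
  not_path : ∀ a b, ¬ PathOn K (Set.Icc 0 p) a b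

namespace NonInsPath

theorem seg (h : NonInsPath K p) {i j : ℕ} (hi : 1 ≤ i) (hij : i ≤ j) (hj : j ≤ p) :
    PathOn K (Set.Icc i j) i j :=
  PathOn.seg hij fun l h1 h2 => h.adj l (by omega) (by omega)

theorem not_adj_one (h : NonInsPath K p) (hp : 1 ≤ p) : ¬ K.Adj 0 1 := fun e =>
  h.not_path _ _ (((PathOn.single 0).append e (h.seg le_rfl hp le_rfl) (by simp)).of_eq
    (by ext x; simp; omega))

theorem not_adj_last (h : NonInsPath K p) (hp : 1 ≤ p) : ¬ K.Adj 0 p := fun e =>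
  h.not_path _ _ (((PathOn.single 0).append e (h.seg le_rfl hp le_rfl).symm (by simp)).of_eq
    (by ext x; simp; omega))

theorem not_adj_consecutive (h : NonInsPath K p) {i : ℕ} (hi : 1 ≤ i) (hip : i < p)
    (hadj : K.Adj 0 i) : ¬ K.Adj 0 (i + 1) := fun e =>
  h.not_path _ _ ((((h.seg le_rfl hi hip.le).append hadj.symm (PathOn.single 0) (by simp)).append
    e (h.seg (by omega) (show i + 1 ≤ p by omega) le_rfl)
    (by rw [Set.disjoint_left]; simp; omega)).of_eq (by ext x; simp; omega))

/-- The part of the path before `i`, the vertex `0`, and the part from `j - 1` back to `m`. -/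
theorem exists_head (h : NonInsPath K p) {i j m : ℕ} (hi : 1 ≤ i) (him : i ≤ m) (hmj : m < j)
    (hj : j ≤ p) (hsi : i = 1 ∨ K.Adj 0 (i - 1)) (hsj : j = 1 ∨ K.Adj 0 (j - 1)) :
    ∃ a, PathOn K (Set.Icc 0 (i - 1) ∪ Set.Icc m (j - 1)) a m := by
  have hsj := hsj.resolve_left (by omega)
  have tail := (h.seg (show 1 ≤ m by omega) (show m ≤ j - 1 by omega)
    (show j - 1 ≤ p by omega)).symm
  by_cases h1 : i = 1
  · subst h1
    exact ⟨0, ((PathOn.single 0).append hsj tail (by simp; omega)).of_eq (by ext x; simp)⟩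
  · have hsi := hsi.resolve_left h1
    refine ⟨1, (((h.seg le_rfl (show 1 ≤ i - 1 by omega) (show i - 1 ≤ p by omega)).append hsi.symm
      (PathOn.single 0) (by simp)).append hsj tail ?_).of_eq ?_⟩
    · rw [Set.disjoint_left]; intro x hx hy; simp at hx hy; omega
    · ext x; simp; omega

/-- Otherwise `1, …, i-1, 0, j-1, …, i, j, …, p` is a path (without its first piece if `i = 1`). -/
theorem not_adj_of_succ (h : NonInsPath K p) {i j : ℕ} (hi : 1 ≤ i) (hij : i < j) (hj : j ≤ p)
    (hsi : i = 1 ∨ K.Adj 0 (i - 1)) (hsj : j = 1 ∨ K.Adj 0 (j - 1)) : ¬ K.Adj i j := by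
  intro e
  obtain ⟨a, ha⟩ := h.exists_head hi le_rfl hij hj hsi hsj
  exact h.not_path _ _ ((ha.append e (h.seg (by omega) hj le_rfl)
    (by rw [Set.disjoint_left]; simp; omega)).of_eq (by ext x; simp; omega))

/-- The same route with its last piece run from `p` back to `j`. Hence `p` sees at most one such
successor, the last of them. -/
theorem not_adj_last_of_succ (h : NonInsPath K p) {i j : ℕ} (hi : 1 ≤ i) (hij : i < j)
    (hj : j ≤ p) (hsi : i = 1 ∨ K.Adj 0 (i - 1)) (hsj : j = 1 ∨ K.Adj 0 (j - 1)) :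
    ¬ K.Adj i p := by
  intro e
  obtain ⟨a, ha⟩ := h.exists_head hi le_rfl hij hj hsi hsj
  exact h.not_path _ _ ((ha.append e (h.seg (by omega) hj le_rfl).symm
    (by rw [Set.disjoint_left]; simp; omega)).of_eq (by ext x; simp; omega))

/-- Consecutive vertices of the path have no two common neighbours among the successors of
neighbours of `0`. -/
theorem not_common (h : NonInsPath K p) {i j w : ℕ} (hi : 1 ≤ i) (hij : i < j) (hj : j ≤ p)
    (hw : 1 ≤ w) (hwp : w < p) (hsi : i = 1 ∨ K.Adj 0 (i - 1)) (hsj : j = 1 ∨ K.Adj 0 (j - 1))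
    (hiw : i ≠ w + 1) (h1 : K.Adj w i) (h2 : K.Adj w j) (h3 : K.Adj (w + 1) i)
    (h4 : K.Adj (w + 1) j) : False := by
  have hiw' : i ≠ w := fun e => K.loopless.irrefl _ (e ▸ h1)
  have hjw' : j ≠ w + 1 := fun e => K.loopless.irrefl _ (e ▸ h4)
  have tail := h.seg (by omega) (show w + 1 ≤ p by omega) le_rfl
  rcases lt_or_ge w i with hwi | hiw
  · have hsi := hsi.resolve_left (by omega)
    have hsj := hsj.resolve_left (by omega)
    -- Route: `1, …, w, i, …, j-1, 0, i-1, …, w+1, j, …, p`.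
    refine h.not_path _ _ ((((((h.seg le_rfl hw hwp.le).append h1
      (h.seg (by omega) (show i ≤ j - 1 by omega) (by omega)) ?_).append hsj.symm
      (PathOn.single 0) ?_).append hsi
      (h.seg (by omega) (show w + 1 ≤ i - 1 by omega) (by omega)).symm ?_).append h4
      (h.seg (by omega) hj le_rfl) ?_).of_eq ?_)
    · rw [Set.disjoint_left]; simp; omega
    · rw [Set.disjoint_left]; simp; omega
    · rw [Set.disjoint_left]; simp; omega
    · rw [Set.disjoint_left]; simp; omega
    · ext x; simp; omega
  rcases lt_or_ge w j with hwj | hjw''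
  -- Route: `1, …, i-1, 0, j-1, …, w+1, i, …, w, j, …, p`.
  · obtain ⟨a, ha⟩ := h.exists_head (m := w + 1) hi (by omega) (by omega) hj hsi hsj
    refine h.not_path _ _ (((ha.append h3 (h.seg (by omega) hiw hwp.le) ?_).append h2
      (h.seg (by omega) hj le_rfl) ?_).of_eq ?_)
    · rw [Set.disjoint_left]; simp; omega
    · rw [Set.disjoint_left]; simp; omega
    · ext x; simp; omega
  -- Route: `1, …, i-1, 0, j-1, …, i, w, …, j, w+1, …, p`.
  · obtain ⟨a, ha⟩ := h.exists_head hi le_rfl hij hj hsi hsj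
    refine h.not_path _ _ (((ha.append h1.symm
      (h.seg (by omega) hjw'' hwp.le).symm ?_).append h4.symm tail ?_).of_eq ?_)
    · rw [Set.disjoint_left]; simp; omega
    · rw [Set.disjoint_left]; simp; omega
    · ext x; simp; omega

end NonInsPath

theorem card_succ_filter [DecidableRel K.Adj] (hp : 1 ≤ p) (hlast : ¬ K.Adj 0 p) :
    ((Finset.Icc 1 p).filter (fun j => j = 1 ∨ K.Adj 0 (j - 1))).card =
      ((Finset.Icc 1 p).filter (K.Adj 0)).card + 1 := by
  have : (Finset.Icc 1 p).filter (fun j => j = 1 ∨ K.Adj 0 (j - 1)) =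
      insert 1 (((Finset.Icc 1 p).filter (K.Adj 0)).image (· + 1)) := by
    ext x
    simp only [Finset.mem_filter, Finset.mem_Icc, Finset.mem_insert, Finset.mem_image]
    constructor
    · rintro ⟨h1, rfl | h2⟩
      · exact Or.inl rfl
      · have : x ≠ 1 := by rintro rfl; exact K.loopless.irrefl _ h2
        exact Or.inr ⟨x - 1, ⟨by omega, h2⟩, by omega⟩
    · rintro (rfl | ⟨y, ⟨h1, h2⟩, rfl⟩)
      · exact ⟨by omega, Or.inl rfl⟩
      · have : y ≠ p := by rintro rfl; exact hlast h2
        exact ⟨by omega, Or.inr h2⟩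
  rw [this, Finset.card_insert_of_notMem, Finset.card_image_of_injective]
  · exact fun x y h => by simpa using h
  · simp

/-- The reversal of the path `1, …, p`, which fixes `0`. -/
def rev (p i : ℕ) : ℕ := if i = 0 then 0 else p + 1 - i

theorem rev_zero (p : ℕ) : rev p 0 = 0 := rfl

theorem rev_of_pos {i : ℕ} (hi : 1 ≤ i) : rev p i = p + 1 - i := if_neg (by omega)

theorem rev_mem {i : ℕ} (hi : i ≤ p) : rev p i ≤ p := by unfold rev; split_ifs <;> omega

theorem rev_rev {i : ℕ} (hi : i ≤ p) : rev p (rev p i) = i := by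
  unfold rev; split_ifs <;> omega

theorem rev_injOn (p : ℕ) : Set.InjOn (rev p) (Set.Icc 0 p) := by
  intro i hi j hj hij
  rw [← rev_rev hi.2, hij, rev_rev hj.2]

theorem rev_image (p : ℕ) : rev p '' Set.Icc 0 p = Set.Icc 0 p := by
  ext x
  constructor
  · rintro ⟨i, hi, rfl⟩
    exact ⟨Nat.zero_le _, rev_mem hi.2⟩
  · rintro hx
    exact ⟨rev p x, ⟨Nat.zero_le _, rev_mem hx.2⟩, rev_rev hx.2⟩

theorem card_filter_rev (q : ℕ → Prop) [DecidablePred q] :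
    ((Finset.Icc 1 p).filter (fun i => q (rev p i))).card = ((Finset.Icc 1 p).filter q).card := by
  refine Finset.card_bij' (fun i _ => rev p i) (fun i _ => rev p i) ?_ ?_ ?_ ?_
  · intro i hi
    simp only [Finset.mem_filter, Finset.mem_Icc] at hi ⊢
    refine ⟨?_, hi.2⟩
    rw [rev_of_pos hi.1.1]; omega
  · intro i hi
    simp only [Finset.mem_filter, Finset.mem_Icc] at hi ⊢
    rw [rev_rev hi.1.2]
    refine ⟨?_, hi.2⟩
    rw [rev_of_pos hi.1.1]; omega
  · intro i hi
    exact rev_rev (Finset.mem_Icc.1 (Finset.mem_filter.1 hi).1).2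
  · intro i hi
    exact rev_rev (Finset.mem_Icc.1 (Finset.mem_filter.1 hi).1).2

/-- A path `1, …, p` with a vertex `0` off the path, and the degree and hole conditions of a tight
counterexample. -/
structure InsConf (K : SimpleGraph ℕ) [DecidableRel K.Adj] (p s t : ℕ) : Prop
    extends NonInsPath K p where
  one_le : 1 ≤ p
  hole : HoleFreeOn K (Finset.Icc 0 p) s t
  not_adj_ends : ¬ K.Adj 1 p
  deg_one : ((Finset.Icc 1 p).filter (K.Adj 0)).card ≤ ((Finset.Icc 1 p).filter (K.Adj 1)).card
  deg_last : ((Finset.Icc 1 p).filter (K.Adj 0)).card ≤ ((Finset.Icc 1 p).filter (K.Adj p)).card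
  card_eq : s + t = ((Finset.Icc 1 p).filter (K.Adj 0)).card + 3
  s_pos : 1 ≤ s
  s_le : s ≤ t
  two_le : 2 ≤ t

namespace InsConf

variable [DecidableRel K.Adj] {s t : ℕ}

/-- The conditions are symmetric, so each fact about successors also gives one about predecessors.
-/
theorem reverse (h : InsConf K p s t) : InsConf (K.comap (rev p)) p s t where
  adj i h1 h2 := by
    have := h.adj (p - i) (by omega) (by omega)
    rw [SimpleGraph.comap_adj, rev_of_pos h1, rev_of_pos (by omega),
      show p + 1 - (i + 1) = p - i by omega, show p + 1 - i = p - i + 1 by omega]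
    exact this.symm
  not_path a b hab := by
    have := hab.of_comap (rev_injOn p)
    rw [rev_image] at this
    exact h.not_path _ _ this
  one_le := h.one_le
  hole := h.hole.comap (fun x hx => by simpa using rev_mem (by simpa using hx))
    (by simpa using rev_injOn p)
  not_adj_ends := by
    have := h.one_le
    rw [SimpleGraph.comap_adj, rev_of_pos le_rfl, rev_of_pos h.one_le,
      show p + 1 - 1 = p by omega, show p + 1 - p = 1 by omega]
    exact fun e => h.not_adj_ends e.symm
  deg_one := by
    simp only [SimpleGraph.comap_adj]
    rw [card_filter_rev (fun i => K.Adj (rev p 0) i), card_filter_rev (fun i => K.Adj (rev p 1) i)]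
    rw [rev_zero, rev_of_pos le_rfl, show p + 1 - 1 = p by omega]
    exact h.deg_last
  deg_last := by
    simp only [SimpleGraph.comap_adj]
    rw [card_filter_rev (fun i => K.Adj (rev p 0) i), card_filter_rev (fun i => K.Adj (rev p p) i)]
    rw [rev_zero, rev_of_pos h.one_le, show p + 1 - p = 1 by omega]
    exact h.deg_one
  card_eq := by
    simp only [SimpleGraph.comap_adj]
    rw [card_filter_rev (fun i => K.Adj (rev p 0) i)]
    exact h.card_eq
  s_pos := h.s_pos
  s_le := h.s_le
  two_le := h.two_le

/-- The successors and `0` form an independent set of `s + t - 1` vertices, just the size for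
`HoleFreeOn.le_card_filter_adj` with `P = {0}`. -/
theorem le_card_adj_succ (h : InsConf K p s t) {w : ℕ} (hw : 1 ≤ w) (hwp : w ≤ p)
    (hws : ¬ (w = 1 ∨ K.Adj 0 (w - 1))) (hwa : ¬ K.Adj 0 w) :
    t ≤ (((Finset.Icc 1 p).filter (fun j => j = 1 ∨ K.Adj 0 (j - 1))).filter (K.Adj w)).card := by
  have hc := card_succ_filter h.one_le (h.not_adj_last h.one_le)
  have := h.card_eq
  have memJ : ∀ x ∈ (Finset.Icc 1 p).filter (fun j => j = 1 ∨ K.Adj 0 (j - 1)),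
      (1 ≤ x ∧ x ≤ p) ∧ (x = 1 ∨ K.Adj 0 (x - 1)) := by
    intro x hx; simpa using hx
  refine h.hole.le_card_filter_adj (P := {0}) ?_ ?_ ?_ ?_ ?_ ?_ ?_ ?_ ?_ ?_ ?_
  · intro x hx
    have := memJ x hx
    simp; omega
  · simp
  · simpa using hwp
  · intro x hx y hy e
    obtain ⟨hx1, hx2⟩ := memJ x hx
    obtain ⟨hy1, hy2⟩ := memJ y hy
    rcases lt_trichotomy x y with hxy | rfl | hxy
    · exact h.not_adj_of_succ hx1.1 hxy hy1.2 hx2 hy2 e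
    · exact K.loopless.irrefl _ e
    · exact h.not_adj_of_succ hy1.1 hxy hx1.2 hy2 hx2 e.symm
  · intro hx
    exact hws (memJ w hx).2
  · simp; omega
  · rw [Finset.disjoint_singleton_right]
    intro hx
    have := memJ 0 hx
    omega
  · intro x hx e
    rw [Finset.mem_singleton] at hx
    exact hwa (hx ▸ e.symm)
  · intro x hx y hy e
    rw [Finset.mem_singleton] at hy
    subst hy
    obtain ⟨hx1, rfl | hx2⟩ := memJ x hx
    · exact h.not_adj_one h.one_le e.symm
    · by_cases hx1' : x = 1
      · subst hx1'; exact h.not_adj_one h.one_le e.symm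
      · have := h.not_adj_consecutive (i := x - 1) (by omega) (by omega) hx2
        rw [show x - 1 + 1 = x by omega] at this
        exact this e.symm
  · rw [hc, Finset.card_singleton]; omega
  · simpa using h.s_pos

/-- If `p` were not a successor it would have `t ≥ 2` neighbours among the successors, but it has at
most one. -/
theorem adj_last_pred (h : InsConf K p s t) : p = 1 ∨ K.Adj 0 (p - 1) := by
  by_contra hcon
  have hle := h.le_card_adj_succ h.one_le le_rfl hcon (h.not_adj_last h.one_le)
  have h2 := h.two_le
  obtain ⟨i, hi, j, hj, hij⟩ := Finset.one_lt_card.1 (lt_of_lt_of_le (show 1 < t by omega) hle)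
  wlog hlt : i < j generalizing i j
  · exact this j hj i hi hij.symm (by omega)
  simp only [Finset.mem_filter, Finset.mem_Icc] at hi hj
  exact h.not_adj_last_of_succ hi.1.1.1 hlt hj.1.1.2 hi.1.2 hj.1.2 hi.2.symm

theorem not_adj_of_pred (h : InsConf K p s t) {i j : ℕ} (hi : 1 ≤ i) (hij : i < j) (hj : j ≤ p)
    (hsi : i = p ∨ K.Adj 0 (i + 1)) (hsj : j = p ∨ K.Adj 0 (j + 1)) : ¬ K.Adj i j := by
  have := h.reverse.not_adj_of_succ (i := p + 1 - j) (j := p + 1 - i) (by omega) (by omega)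
    (by omega) ?_ ?_
  · rw [SimpleGraph.comap_adj, rev_of_pos (by omega), rev_of_pos (by omega),
      show p + 1 - (p + 1 - j) = j by omega, show p + 1 - (p + 1 - i) = i by omega] at this
    exact fun e => this e.symm
  · by_cases hjp : j = p
    · exact Or.inl (by omega)
    · refine Or.inr ?_
      rw [SimpleGraph.comap_adj, rev_zero, rev_of_pos (by omega),
        show p + 1 - (p + 1 - j - 1) = j + 1 by omega]
      exact hsj.resolve_left hjp
  · refine Or.inr ?_
    rw [SimpleGraph.comap_adj, rev_zero, rev_of_pos (by omega),
      show p + 1 - (p + 1 - i - 1) = i + 1 by omega]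
    exact hsi.resolve_left (by omega)

theorem adj_one_succ (h : InsConf K p s t) : p = 1 ∨ K.Adj 0 2 := by
  rcases h.reverse.adj_last_pred with h1 | h1
  · exact Or.inl h1
  · by_cases hp : p = 1
    · exact Or.inl hp
    · have := h.one_le
      rw [SimpleGraph.comap_adj, rev_zero, rev_of_pos (by omega),
        show p + 1 - (p - 1) = 2 by omega] at h1
      exact Or.inr h1

/-- Otherwise `w` and `w + 1` each have `t` neighbours among the `s + t - 2 ≤ 2t - 2` successors,
hence two in common, against `not_common`. -/
theorem adj_succ_of_not (h : InsConf K p s t) {w : ℕ} (hw : 1 ≤ w) (hwp : w ≤ p)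
    (hws : ¬ (w = 1 ∨ K.Adj 0 (w - 1))) (hwa : ¬ K.Adj 0 w) : w < p ∧ K.Adj 0 (w + 1) := by
  have hne : w ≠ p := by
    rintro rfl
    exact hws h.adj_last_pred
  refine ⟨by omega, ?_⟩
  by_contra hcon
  have c1 := h.le_card_adj_succ hw hwp hws hwa
  have c2 := h.le_card_adj_succ (w := w + 1) (by omega) (by omega)
    (by rintro (h1 | h1); exacts [by omega, hwa h1]) hcon
  have hc := card_succ_filter h.one_le (h.not_adj_last h.one_le)
  set J := (Finset.Icc 1 p).filter (fun j => j = 1 ∨ K.Adj 0 (j - 1)) with hJ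
  have h1 := h.card_eq
  have h2 := h.s_le
  have h3 := Finset.card_union_add_card_inter (J.filter (K.Adj w)) (J.filter (K.Adj (w + 1)))
  have h4 := Finset.card_le_card (Finset.union_subset (Finset.filter_subset (K.Adj w) J)
    (Finset.filter_subset (K.Adj (w + 1)) J))
  obtain ⟨i, hi, j, hj, hij⟩ := Finset.one_lt_card.1 (show 1 < (J.filter (K.Adj w) ∩
    J.filter (K.Adj (w + 1))).card by omega)
  wlog hlt : i < j generalizing i j
  · exact this j hj i hi hij.symm (by omega)
  simp only [hJ, Finset.mem_inter, Finset.mem_filter, Finset.mem_Icc] at hi hj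
  refine h.not_common hi.1.1.1.1 hlt hj.1.1.1.2 hw (by omega) hi.1.1.2 hj.1.1.2 ?_
    hi.1.2 hj.1.2 hi.2.2 hj.2.2
  · rintro rfl
    exact K.loopless.irrefl _ hi.2.2

/-- A neighbour of `1` that is not one of `0` would be a successor or a predecessor of a neighbour
of `0`; `1` is of both kinds, and each kind is independent. So the neighbourhood of `1` lies in that
of `0`, and the degrees force equality. -/
theorem adj_one_of_adj (h : InsConf K p s t) {b : ℕ} (hb : 1 ≤ b) (hbp : b ≤ p)
    (hadj : K.Adj 0 b) : K.Adj 1 b := by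
  have hsub : (Finset.Icc 1 p).filter (K.Adj 1) ⊆ (Finset.Icc 1 p).filter (K.Adj 0) := by
    intro i hi
    simp only [Finset.mem_filter, Finset.mem_Icc] at hi ⊢
    refine ⟨hi.1, ?_⟩
    by_contra hcon
    have hi1 : i ≠ 1 := by rintro rfl; exact K.loopless.irrefl _ hi.2
    by_cases hs : i = 1 ∨ K.Adj 0 (i - 1)
    · exact h.not_adj_of_succ le_rfl (by omega) hi.1.2 (Or.inl rfl) hs hi.2
    · have := h.adj_succ_of_not hi.1.1 hi.1.2 hs hcon
      exact h.not_adj_of_pred le_rfl (by omega) hi.1.2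
        (h.adj_one_succ.imp Eq.symm id) (Or.inr this.2) hi.2
  have heq := Finset.eq_of_subset_of_card_le hsub h.deg_one
  have : b ∈ (Finset.Icc 1 p).filter (K.Adj 0) := by simp [hb, hbp, hadj]
  rw [← heq] at this
  exact (Finset.mem_filter.1 this).2

/-- All the `t` or more successors adjacent to `w` lie before `w`; shifting them back by one gives
neighbours of `0`. -/
theorem le_card_adj_lt (h : InsConf K p s t) {w : ℕ} (hw : 1 ≤ w) (hwp : w ≤ p)
    (hws : ¬ (w = 1 ∨ K.Adj 0 (w - 1))) (hwa : ¬ K.Adj 0 w) :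
    t ≤ (((Finset.Icc 1 p).filter (K.Adj 0)).filter (· < w)).card := by
  obtain ⟨hwlt, hw1⟩ := h.adj_succ_of_not hw hwp hws hwa
  refine (h.le_card_adj_succ hw hwp hws hwa).trans ?_
  rw [← Finset.card_image_of_injective (((Finset.Icc 1 p).filter (K.Adj 0)).filter (· < w))
    (f := (· + 1)) (fun x y hxy => by simpa using hxy)]
  refine Finset.card_le_card fun x hx => ?_
  simp only [Finset.mem_filter, Finset.mem_Icc] at hx
  obtain ⟨⟨⟨hx1, hxp⟩, hxs⟩, hwx⟩ := hx
  have hx1' : x ≠ 1 := by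
    rintro rfl
    exact h.not_adj_of_pred le_rfl (by omega) hwp (h.adj_one_succ.imp Eq.symm id) (Or.inr hw1)
      hwx.symm
  have hxs := hxs.resolve_left hx1'
  have hxw : x ≤ w := by
    by_contra hlt
    have hne : x ≠ w + 1 := by
      rintro rfl
      exact hwa (by simpa using hxs)
    have hone := h.adj_one_of_adj (b := w + 1) (by omega) (by omega) hw1
    -- Route: `p, …, x, w, …, 1, w+1, …, x-1, 0`.
    refine h.not_path _ _ (((((h.seg (by omega) hxp le_rfl).symm.append hwx.symm
      (h.seg le_rfl hw hwp).symm ?_).append hone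
      (h.seg (by omega) (show w + 1 ≤ x - 1 by omega) (by omega)) ?_).append hxs.symm
      (PathOn.single 0) ?_).of_eq ?_)
    · rw [Set.disjoint_left]; simp; omega
    · rw [Set.disjoint_left]; simp; omega
    · rw [Set.disjoint_left]; simp; omega
    · ext y; simp; omega
  simp only [Finset.mem_image, Finset.mem_filter, Finset.mem_Icc]
  exact ⟨x - 1, ⟨⟨by omega, hxs⟩, by omega⟩, by omega⟩

/-- An exceptional `w` gives `t` neighbours of `0` before it. In the reversed path `w - 1` is
exceptional as well and gives `t` more on the other side, but `0` has only `s + t - 3 < 2t`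
neighbours. -/
theorem succ_or_adj (h : InsConf K p s t) {w : ℕ} (hw : 1 ≤ w) (hwp : w ≤ p) :
    (w = 1 ∨ K.Adj 0 (w - 1)) ∨ K.Adj 0 w := by
  by_contra hcon
  rw [not_or] at hcon
  obtain ⟨hws, hwa⟩ := hcon
  have hw1 : w ≠ 1 := fun e => hws (Or.inl e)
  have h1 := h.le_card_adj_lt hw hwp hws hwa
  have h2 := h.reverse.le_card_adj_lt (w := p + 1 - (w - 1)) (by omega) (by omega) ?_ ?_
  · rw [Finset.filter_filter] at h1 h2
    simp only [SimpleGraph.comap_adj] at h2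
    have h3 : ((Finset.Icc 1 p).filter fun a => K.Adj (rev p 0) (rev p a) ∧
        a < p + 1 - (w - 1)) = (Finset.Icc 1 p).filter fun a => K.Adj 0 (rev p a) ∧ ¬ rev p a < w := by
      refine Finset.filter_congr fun a ha => ?_
      rw [Finset.mem_Icc] at ha
      rw [rev_zero, rev_of_pos ha.1]
      refine and_congr_right fun _ => ?_
      omega
    rw [h3, card_filter_rev (fun a => K.Adj 0 a ∧ ¬ a < w), ← Finset.filter_filter] at h2
    rw [← Finset.filter_filter] at h1
    have h4 := Finset.card_filter_add_card_filter_not (s := (Finset.Icc 1 p).filter (K.Adj 0))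
      (· < w)
    have h5 := h.card_eq
    have h6 := h.s_le
    omega
  · rintro (h3 | h3)
    · omega
    · rw [SimpleGraph.comap_adj, rev_zero, rev_of_pos (by omega),
        show p + 1 - (p + 1 - (w - 1) - 1) = w by omega] at h3
      exact hwa h3
  · rw [SimpleGraph.comap_adj, rev_zero, rev_of_pos (by omega),
        show p + 1 - (p + 1 - (w - 1)) = w - 1 by omega]
    exact fun e => hws (Or.inr e)

/-- In a tight configuration, neighbours of `0` and their successors alternate on the path. -/
theorem length_eq (h : InsConf K p s t) : p = 2 * ((Finset.Icc 1 p).filter (K.Adj 0)).card + 1 := by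
  have hc := card_succ_filter h.one_le (h.not_adj_last h.one_le)
  have hu := Finset.card_union_of_disjoint
    (s := (Finset.Icc 1 p).filter (fun j => j = 1 ∨ K.Adj 0 (j - 1)))
    (t := (Finset.Icc 1 p).filter (K.Adj 0)) ?_
  · rw [← Finset.filter_or, Finset.filter_true_of_mem, Nat.card_Icc] at hu
    · omega
    · intro w hw
      rw [Finset.mem_Icc] at hw
      exact h.succ_or_adj hw.1 hw.2
  · rw [Finset.disjoint_left]
    intro x hx hy
    simp only [Finset.mem_filter, Finset.mem_Icc] at hx hy
    by_cases hx1 : x = 1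
    · subst hx1
      exact h.not_adj_one h.one_le hy.2
    · have := h.not_adj_consecutive (i := x - 1) (by omega) (by omega) (hx.2.resolve_left hx1)
      rw [show x - 1 + 1 = x by omega] at this
      exact this hy.2

end InsConf
end

end BipartiteHole

/-! ### The cone, and the degrees of the ends of two covering paths. -/

namespace BipartiteHole

section

variable {V : Type*} {G : SimpleGraph V}

/-- The cone over `G`: one new vertex `none` joined to all vertices of `G`. -/
def cone (G : SimpleGraph V) : SimpleGraph (Option V) where
  Adj x y := x ≠ y ∧ ∀ a b, x = some a → y = some b → G.Adj a b
  symm := ⟨fun _ _ h => ⟨h.1.symm, fun a b ha hb => (h.2 b a hb ha).symm⟩⟩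
  loopless := ⟨fun _ h => h.1 rfl⟩

@[simp] theorem cone_adj_some {a b : V} : (cone G).Adj (some a) (some b) ↔ G.Adj a b := by
  refine ⟨fun h => h.2 a b rfl rfl, fun h => ⟨by simpa using h.ne, ?_⟩⟩
  rintro _ _ ⟨⟩ ⟨⟩
  exact h

@[simp] theorem cone_adj_none {a : V} : (cone G).Adj (some a) none := by
  simp [cone]

/-- Deleting the apex from a Hamilton cycle of the cone leaves a Hamilton path of `G`. -/
theorem cone_not_adj_of_path [Nonempty V] (hG : ∀ a b, ¬ PathOn G Set.univ a b) {x y : Option V}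
    (h : PathOn (cone G) Set.univ x y) : ¬ (cone G).Adj x y := by
  intro hadj
  obtain ⟨d, hd⟩ := h.rotate (Or.inr hadj) (Set.mem_univ none)
  obtain ⟨v⟩ := ‹Nonempty V›
  rcases hd.symm.diff_start with h0 | ⟨c, -, hc⟩
  · have : some v ∈ (Set.univ \ {none} : Set (Option V)) := by simp
    rw [h0] at this
    exact this
  · have := hc.map (K := G) (fun o => o.getD v) ?_ ?_
    · refine hG _ _ (this.of_eq ?_)
      ext u
      simp only [Set.mem_image, Set.mem_univ, iff_true]
      exact ⟨some u, by simp, rfl⟩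
    · rintro (_ | x) hx (_ | y) hy e
      · simp at hx
      · simp at hx
      · simp at hy
      · simpa using e
    · rintro (_ | x) hx (_ | y) hy e
      · rfl
      · simp at hx
      · simp at hy
      · simpa using e

/-- The apex sees every other vertex, so it lies in neither side of a pair of non-empty sets without
edges between them. -/
theorem HoleFreeOn.cone [Fintype V] {s t : ℕ} (h : HoleFreeOn G Finset.univ s t) (hs : 1 ≤ s)
    (ht : 1 ≤ t) : HoleFreeOn (cone G) Finset.univ s t := by
  classical
  have key : ∀ X Y : Finset (Option V), Disjoint X Y →
      (∀ x ∈ X, ∀ y ∈ Y, ¬ (BipartiteHole.cone G).Adj x y) → Y.Nonempty →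
      X.eraseNone.card = X.card := by
    intro X Y hd hn ⟨y, hy⟩
    refine (Finset.card_eraseNone_of_not_mem ?_)
    intro hX
    rcases y with _ | y
    · exact Finset.disjoint_left.1 hd hX hy
    · exact hn _ hX _ hy cone_adj_none.symm
  intro X Y _ _ hd hn hX
  by_contra hY
  have hX' := key X Y hd hn (Finset.card_pos.1 (by omega))
  have hY' := key Y X hd.symm (fun x hx y hy e => hn y hy x hx e.symm)
    (Finset.card_pos.1 (by omega))
  have := h X.eraseNone Y.eraseNone (Finset.subset_univ _) (Finset.subset_univ _) ?_ ?_ (by omega)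
  · omega
  · rw [Finset.disjoint_left]
    intro x hx hy
    exact Finset.disjoint_left.1 hd (Finset.mem_eraseNone.1 hx) (Finset.mem_eraseNone.1 hy)
  · intro x hx y hy
    simpa using hn _ (Finset.mem_eraseNone.1 hx) _ (Finset.mem_eraseNone.1 hy)

theorem card_comap_adj {W : Type*} [Fintype W] {H : SimpleGraph W} [DecidableRel H.Adj]
    {U : Finset ℕ} {v : ℕ → W} (hinj : Set.InjOn v U) (hsurj : ∀ w, ∃ i ∈ U, v i = w) (j : ℕ) :
    (U.filter ((H.comap v).Adj j)).card = (Finset.univ.filter (H.Adj (v j))).card := by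
  refine Finset.card_bij (fun i _ => v i) ?_ ?_ ?_
  · intro i hi
    simpa using (Finset.mem_filter.1 hi).2
  · intro i hi i' hi' e
    exact hinj (Finset.mem_filter.1 hi).1 (Finset.mem_filter.1 hi').1 e
  · intro w hw
    obtain ⟨i, hi, rfl⟩ := hsurj w
    exact ⟨i, Finset.mem_filter.2 ⟨hi, by simpa using hw⟩, rfl⟩

theorem card_cone_adj_some [Fintype V] [DecidableRel G.Adj] [DecidableRel (cone G).Adj] (a : V) :
    (Finset.univ.filter ((cone G).Adj (some a))).card = G.degree a + 1 := by
  rw [← G.card_neighborFinset_eq_degree, ← Finset.card_insertNone]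
  congr 1
  ext (_ | x) <;> simp

/-- Two disjoint paths covering `G`, where `G` has no Hamilton path and no `(s,t)`-hole: the degrees
of their ends are bounded, and in the tight case the last vertex of the second path is adjacent to
the whole of it, provided that no end of the first vertex set has neighbours outside. -/
theorem degree_le_of_cover [Fintype V] [DecidableRel G.Adj]
    (hG : ∀ a b, ¬ PathOn G Set.univ a b) {s t : ℕ} (hole : HoleFreeOn G Finset.univ s t)
    (hs : 1 ≤ s) (ht : 2 ≤ t) {S : Set V} {a b c d : V} (h1 : PathOn G S a b)
    (h2 : PathOn G Sᶜ c d) (ha : s + t ≤ G.degree a + 3) :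
    G.degree d + 3 ≤ s + t ∧ ((∀ e f, PathOn G S e f → ∀ w ∉ S, ¬ G.Adj e w) →
      G.degree d + 3 = s + t → ∀ w ∉ S, w ≠ d → G.Adj d w) := by
  classical
  have : Nonempty V := ⟨a⟩
  obtain ⟨m, v, hm, hvinj, hvS, hv1, hvm, hvadj⟩ := h1.enumerate
  obtain ⟨m', u, hm', huinj, huS, hu1, hum, huadj⟩ := h2.enumerate
  have vmem : ∀ i, 1 ≤ i → i ≤ m → v i ∈ S := fun i h1 h2 => hvS ▸ ⟨i, ⟨h1, h2⟩, rfl⟩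
  have umem : ∀ i, 1 ≤ i → i ≤ m' → u i ∉ S := fun i h1 h2 =>
    (huS ▸ ⟨i, ⟨h1, h2⟩, rfl⟩ : u i ∈ Sᶜ)
  -- The first path at `1, …, m`, the apex at `m + 1`, the second path after it.
  set f : ℕ → Option V := fun i =>
    if i ≤ m then some (v i) else if i = m + 1 then none else some (u (i - (m + 1))) with hf
  have f1 : ∀ i, i ≤ m → f i = some (v i) := fun i hi => by simp [hf, hi]
  have f2 : f (m + 1) = none := by simp [hf]
  have f3 : ∀ i, 1 ≤ i → f (m + 1 + i) = some (u i) := fun i hi => by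
    simp [hf, show ¬ (m + 1 + i ≤ m) by omega, show i ≠ 0 by omega]
  have cases_idx : ∀ i, 1 ≤ i → i ≤ m + 1 + m' →
      (i ≤ m) ∨ i = m + 1 ∨ ∃ j, 1 ≤ j ∧ j ≤ m' ∧ i = m + 1 + j := by
    intro i h1 h2
    rcases lt_trichotomy i (m + 1) with h | h | h
    · exact Or.inl (by omega)
    · exact Or.inr (Or.inl h)
    · exact Or.inr (Or.inr ⟨i - (m + 1), by omega, by omega, by omega⟩)
  have finj : Set.InjOn f (Set.Icc 1 (m + 1 + m')) := by
    intro i hi j hj hij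
    rcases cases_idx i hi.1 hi.2 with h | rfl | ⟨i', hi1, hi2, rfl⟩ <;>
      rcases cases_idx j hj.1 hj.2 with h' | rfl | ⟨j', hj1, hj2, rfl⟩
    · rw [f1 i h, f1 j h', Option.some_inj] at hij
      exact hvinj ⟨hi.1, h⟩ ⟨hj.1, h'⟩ hij
    · simp [f1 i h, f2] at hij
    · rw [f1 i h, f3 j' hj1, Option.some_inj] at hij
      exact absurd (hij ▸ vmem i hi.1 h) (umem j' hj1 hj2)
    · simp [f1 j h', f2] at hij
    · rfl
    · simp [f3 j' hj1, f2] at hij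
    · rw [f1 j h', f3 i' hi1, Option.some_inj] at hij
      exact absurd (hij ▸ vmem j hj.1 h') (umem i' hi1 hi2)
    · simp [f3 i' hi1, f2] at hij
    · rw [f3 i' hi1, f3 j' hj1, Option.some_inj] at hij
      rw [huinj ⟨hi1, hi2⟩ ⟨hj1, hj2⟩ hij]
  have fsurj : ∀ w, ∃ i ∈ Finset.Icc 1 (m + 1 + m'), f i = w := by
    rintro (_ | w)
    · exact ⟨m + 1, by simp, f2⟩
    · by_cases hw : w ∈ S
      · rw [← hvS] at hw
        obtain ⟨i, hi, rfl⟩ := hw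
        exact ⟨i, by have := hi.2; simp [hi.1]; omega, f1 i hi.2⟩
      · have hw : w ∈ Sᶜ := hw
        rw [← huS] at hw
        obtain ⟨i, hi, rfl⟩ := hw
        exact ⟨m + 1 + i, by have := hi.2; simp; omega, f3 i hi.1⟩
  have hf1 : f 1 = some a := by rw [f1 1 hm, hv1]
  have hfN : f (m + 1 + m') = some d := by rw [f3 m' hm', hum]
  have hK : NonHamPath ((cone G).comap f) (m + 1 + m') := by
    refine ⟨fun i hi1 hi2 => ?_, fun x y hxy => ?_⟩
    · rw [SimpleGraph.comap_adj]
      rcases cases_idx i hi1 hi2.le with h | rfl | ⟨i', hi1', hi2', rfl⟩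
      · rcases h.lt_or_eq with h' | rfl
        · rw [f1 i h, f1 (i + 1) h', cone_adj_some]
          exact hvadj i hi1 h'
        · rw [f1 i h, f2]
          exact cone_adj_none
      · rw [f2, f3 1 le_rfl]
        exact cone_adj_none.symm
      · rw [f3 i' hi1', add_assoc (m + 1), f3 (i' + 1) (by omega), cone_adj_some]
        exact huadj i' hi1' (by omega)
    · refine cone_not_adj_of_path hG ((hxy.of_comap finj).of_eq ?_)
      ext w
      obtain ⟨i, hi, rfl⟩ := fsurj w
      simp only [Set.mem_univ, iff_true]
      exact ⟨i, by simpa using hi, rfl⟩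
  have finj' : Set.InjOn f (Finset.Icc 1 (m + 1 + m')) := by simpa using finj
  have hholeK : HoleFreeOn ((cone G).comap f) (Finset.Icc 1 (m + 1 + m')) s t :=
    (hole.cone hs (by omega)).comap (fun _ _ => by simp) finj'
  have cA : ((Finset.Icc 1 (m + 1 + m')).filter (((cone G).comap f).Adj 1)).card =
      G.degree a + 1 := by
    rw [card_comap_adj finj' fsurj, hf1, card_cone_adj_some]
  have cB : ((Finset.Icc 1 (m + 1 + m')).filter (((cone G).comap f).Adj (m + 1 + m'))).card =
      G.degree d + 1 := by
    rw [card_comap_adj finj' fsurj, hfN, card_cone_adj_some]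
  -- Degrees are one larger in the cone, which turns the bound `s + t - 2` into `s + t - 3`.
  obtain ⟨hle, heq⟩ := hK.card_le_and hholeK hs (by omega) (by omega)
  refine ⟨by omega, fun hends hd w hw hwd => ?_⟩
  have hw' : w ∈ Sᶜ := hw
  rw [← huS] at hw'
  obtain ⟨j, hj, rfl⟩ := hw'
  have hjm : j ≠ m' := by rintro rfl; exact hwd hum
  have hj' : j < m' := lt_of_le_of_ne hj.2 hjm
  -- The equality case is applied to the successor of `u j`. Each rotated start is an end of a path
  -- on `S`, so it sees nothing outside `S`.
  have := heq (by omega) (m + 1 + (j + 1)) (by simp; omega) ?_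
  · have h3 := this.2
    rw [show m + 1 + (j + 1) - 1 = m + 1 + j by omega, SimpleGraph.comap_adj, hfN, f3 j hj.1,
      cone_adj_some] at h3
    exact h3
  · intro i hi hadj
    rw [Finset.mem_Icc] at hi
    have hi1 : i ≠ 1 := by rintro rfl; exact SimpleGraph.irrefl _ hadj
    rw [SimpleGraph.comap_adj, hf1] at hadj
    have hsegv : ∀ i j, 1 ≤ i → i ≤ j → j ≤ m → PathOn G (v '' Set.Icc i j) (v i) (v j) :=
      fun i j h1 h2 h3 => (PathOn.seg (K := G.comap v) h2 fun l hl1 hl2 =>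
        hvadj l (by omega) (by omega)).of_comap (hvinj.mono (Set.Icc_subset_Icc h1 h3))
    have hend : i ≤ m + 1 ∧ ∃ x, PathOn G S (v (i - 1)) x := by
      rcases cases_idx i hi.1 hi.2 with h | rfl | ⟨i', hi1', hi2', rfl⟩
      · rw [f1 i h, cone_adj_some] at hadj
        refine ⟨by omega, v m, ((hsegv 1 (i - 1) le_rfl (by omega) (by omega)).symm.append
          (hv1 ▸ hadj) (hsegv i m (by omega) h le_rfl) ?_).of_eq ?_⟩
        · rw [Set.disjoint_left]
          rintro _ ⟨x, hx, rfl⟩ ⟨y, hy, hxy⟩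
          have := hvinj ⟨by have := hy.1; omega, hy.2⟩ ⟨hx.1, by have := hx.2; omega⟩ hxy
          have := hx.2; have := hy.1
          omega
        · rw [← hvS, ← Set.image_union]
          congr 1
          ext x; simp; omega
      · exact ⟨le_rfl, a, by rw [Nat.add_sub_cancel, hvm]; exact h1.symm⟩
      · rw [f3 i' hi1', cone_adj_some] at hadj
        exact absurd hadj (hends a b h1 _ (umem i' hi1' hi2'))
    refine ⟨by omega, ?_⟩
    obtain ⟨him, x, hx⟩ := hend
    rw [SimpleGraph.comap_adj, f1 (i - 1) (by omega), f3 (j + 1) (by omega), cone_adj_some]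
    exact hends _ _ hx _ (umem (j + 1) (by omega) (by omega))

end

end BipartiteHole

/-! ### Maximal covers and the structure of an edge-maximal counterexample. -/

namespace BipartiteHole

section

variable {V : Type*} {G : SimpleGraph V}

theorem exists_adj_boundary (hconn : G.Connected) {S : Set V} (hS : S.Nonempty)
    (hS' : Sᶜ.Nonempty) : ∃ x ∈ S, ∃ y ∉ S, G.Adj x y := by
  obtain ⟨a, ha⟩ := hS
  obtain ⟨b, hb⟩ := hS'
  obtain ⟨p⟩ := hconn.preconnected a b
  obtain ⟨d, -, h1, h2⟩ := p.exists_boundary_dart S ha hb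
  exact ⟨_, h1, _, h2, d.adj⟩

variable [Fintype V]

/-- `G` has no Hamilton path, `S` and its complement carry paths, and `S` is as large as possible
with this property. -/
structure MaxCover (G : SimpleGraph V) (S : Set V) : Prop where
  not_path : ∀ a b, ¬ PathOn G Set.univ a b
  path : ∃ a b, PathOn G S a b
  path_compl : ∃ a b, PathOn G Sᶜ a b
  le : ∀ T a b c d, PathOn G T a b → PathOn G Tᶜ c d → T.ncard ≤ S.ncard

theorem exists_maxCover (hG : ∀ a b, ¬ PathOn G Set.univ a b)
    (h : ∃ S a b c d, PathOn G S a b ∧ PathOn G Sᶜ c d) : ∃ S, MaxCover G S := by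
  obtain ⟨S₀, a, b, c, d, h1, h2⟩ := h
  obtain ⟨S, ⟨hS1, hS2⟩, hmax⟩ := Set.exists_max_image
    {S : Set V | (∃ a b, PathOn G S a b) ∧ ∃ a b, PathOn G Sᶜ a b} Set.ncard (Set.toFinite _)
    ⟨S₀, ⟨a, b, h1⟩, c, d, h2⟩
  exact ⟨S, hG, hS1, hS2, fun T a b c d h1 h2 => hmax T ⟨⟨a, b, h1⟩, c, d, h2⟩⟩

namespace MaxCover

variable {S : Set V}

theorem not_path_of_ssubset (h : MaxCover G S) {T : Set V} (hST : S ⊂ T)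
    (hT : Tᶜ = ∅ ∨ ∃ c d, PathOn G Tᶜ c d) (a b : V) : ¬ PathOn G T a b := by
  intro hab
  rcases hT with hT | ⟨c, d, hcd⟩
  · rw [Set.compl_empty_iff] at hT
    exact h.not_path a b (hT ▸ hab)
  · have := h.le T a b c d hab hcd
    have := Set.ncard_lt_ncard hST (Set.toFinite _)
    omega

/-- Otherwise the piece of the other path from `w` to its end could be moved over to `S`. -/
theorem not_adj_of_end (h : MaxCover G S) {e f w : V} (hef : PathOn G S e f) (hw : w ∉ S) :
    ¬ G.Adj e w := by
  intro hadj
  obtain ⟨c, d, hcd⟩ := h.path_compl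
  by_cases hwc : w = c
  · subst hwc
    refine h.not_path f d ((hef.symm.append hadj hcd disjoint_compl_right).of_eq (by simp))
  · obtain ⟨S₁, S₂, x, h1, -, h2, hd, hu⟩ := hcd.split hw hwc
    have hS2 : Disjoint S S₂ :=
      disjoint_compl_right.mono_right (hu ▸ Set.subset_union_right)
    have hcompl : (S ∪ S₂)ᶜ = S₁ := by
      rw [Set.compl_union, ← hu, Set.union_inter_distrib_right, Set.inter_compl_self,
        Set.union_empty]
      exact Set.inter_eq_left.2 (Set.subset_compl_iff_disjoint_right.2 hd)
    refine h.not_path_of_ssubset (T := S ∪ S₂) ?_ (Or.inr ⟨c, x, hcompl ▸ h1⟩) f d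
      (hef.symm.append hadj h2 hS2)
    exact Set.ssubset_iff_of_subset Set.subset_union_left |>.2
      ⟨w, Or.inr h2.start_mem, hw⟩

/-- If the path on `S` closed up, any vertex of `S` would be an end of a path on `S`, including one
which connectedness joins to the complement. -/
theorem ends (h : MaxCover G S) (hconn : G.Connected) {e f : V} (hef : PathOn G S e f) :
    e ≠ f ∧ ¬ G.Adj e f := by
  rw [← not_or]
  intro hcyc
  obtain ⟨c, d, hcd⟩ := h.path_compl
  obtain ⟨x, hx, y, hy, hxy⟩ := exists_adj_boundary hconn ⟨e, hef.start_mem⟩ ⟨c, hcd.start_mem⟩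
  obtain ⟨z, hz⟩ := hef.rotate hcyc hx
  exact h.not_adj_of_end hz.symm hy hxy

end MaxCover

/-- The hypotheses on an edge-maximal counterexample: `G` is connected and without Hamilton path,
any two non-adjacent vertices are the ends of two disjoint paths covering `G`, there is no
`(s,t)`-hole, and the sum of the degrees of non-adjacent vertices is at least `2(s+t-1)-4`. -/
structure Counterexample (G : SimpleGraph V) [DecidableRel G.Adj] (s t : ℕ) : Prop where
  conn : G.Connected
  not_path : ∀ a b, ¬ PathOn G Set.univ a b
  cover : ∀ x y, x ≠ y → ¬ G.Adj x y → ∃ T a b, PathOn G T x a ∧ PathOn G Tᶜ b y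
  hole : HoleFreeOn G Finset.univ s t
  s_pos : 1 ≤ s
  s_le : s ≤ t
  two_le : 2 ≤ t
  deg : ∀ x y, x ≠ y → ¬ G.Adj x y → 2 * (s + t) ≤ G.degree x + G.degree y + 6

namespace Counterexample

variable [DecidableRel G.Adj] {s t : ℕ} {S : Set V}

/-- The vertices `e`, `f`, `d` are pairwise non-adjacent. If one of `e`, `d` had degree below `s + t
- 3`, the other two would exceed it; yet two ends of a suitable cover by two paths never both do. -/
theorem degree_ends (h : Counterexample G s t) (hS : MaxCover G S) {e f c d : V}
    (hef : PathOn G S e f) (hcd : PathOn G Sᶜ c d) :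
    G.degree e + 3 = s + t ∧ G.degree d + 3 = s + t := by
  have hne : ∀ {x}, x ∈ S → x ≠ d := fun hx e => hcd.end_mem (e ▸ hx)
  have h1 := h.deg e d (hne hef.start_mem) (hS.not_adj_of_end hef hcd.end_mem)
  have h2 := h.deg f d (hne hef.end_mem) (hS.not_adj_of_end hef.symm hcd.end_mem)
  obtain ⟨hnef, hadj⟩ := hS.ends h.conn hef
  have h3 := h.deg e f hnef hadj
  have key : ∀ {T : Set V} {a b c d : V}, PathOn G T a b → PathOn G Tᶜ c d →
      s + t ≤ G.degree a + 3 → G.degree d + 3 ≤ s + t := fun h1 h2 h3 =>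
    (degree_le_of_cover h.not_path h.hole h.s_pos h.two_le h1 h2 h3).1
  have he : s + t ≤ G.degree e + 3 := by
    by_contra hlow
    have := key hef.symm hcd (by omega)
    omega
  have hd : s + t ≤ G.degree d + 3 := by
    by_contra hlow
    obtain ⟨T, a, b, hT1, hT2⟩ := h.cover e f hnef hadj
    have := key hT1 hT2 he
    omega
  have h4 := key hef hcd he
  have h5 := key hcd.symm (by rw [compl_compl]; exact hef.symm) hd
  omega

theorem adj_compl (h : Counterexample G s t) (hS : MaxCover G S) {w w' : V} (hw : w ∉ S)
    (hw' : w' ∉ S) (hne : w ≠ w') : G.Adj w w' := by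
  obtain ⟨e, f, hef⟩ := hS.path
  obtain ⟨c, d, hcd⟩ := hS.path_compl
  have key : ∀ {c d : V}, PathOn G Sᶜ c d → ∀ w ∉ S, w ≠ d → G.Adj d w := by
    intro c d hcd
    obtain ⟨h1, h2⟩ := h.degree_ends hS hef hcd
    exact (degree_le_of_cover h.not_path h.hole h.s_pos h.two_le hef hcd h1.ge).2
      (fun e f hef w hw => hS.not_adj_of_end hef hw) h2
  -- The end `d` sees the whole complement, so the path there closes up and any `w` can take the
  -- place of `d`.
  obtain ⟨x, hx⟩ := hcd.rotate (c := w) (by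
    by_cases hcd' : c = d
    · exact Or.inl hcd'
    · exact Or.inr (key hcd c hcd.start_mem hcd').symm) hw
  exact key hx w' hw' hne.symm

/-- As the complement is a clique, enlarging `S` to the vertex set of any path contradicts
maximality. -/
theorem path_or_empty (h : Counterexample G s t) (hS : MaxCover G S) {T : Set V}
    (hST : S ⊆ T) : Tᶜ = ∅ ∨ ∃ c d, PathOn G Tᶜ c d := by
  rcases Tᶜ.eq_empty_or_nonempty with h0 | h0
  · exact Or.inl h0
  · exact Or.inr (PathOn.exists_of_clique (Set.toFinite _) h0 fun x hx y hy hxy =>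
      h.adj_compl hS (fun hxS => hx (hST hxS)) (fun hyS => hy (hST hyS)) hxy)

set_option maxHeartbeats 1000000 in
/-- An edge-maximal counterexample has an independent set of `s + t - 1` vertices, which is one more
than half of its order. -/
theorem exists_indep (h : Counterexample G s t) : ∃ I : Finset V,
    (∀ x ∈ I, ∀ y ∈ I, ¬ G.Adj x y) ∧ I.card + 1 = s + t ∧ 2 * I.card = Fintype.card V + 2 := by
  classical
  have hs1 := h.s_pos
  have hst := h.s_le
  have ht2 := h.two_le
  obtain ⟨S, hS⟩ : ∃ S, MaxCover G S := by
    refine exists_maxCover h.not_path ?_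
    have := h.conn.nonempty
    by_contra hcon
    obtain ⟨a, b, hab⟩ := PathOn.exists_of_clique (G := G) (Set.toFinite Set.univ)
      Set.univ_nonempty (fun x _ y _ hxy => by
        by_contra hadj
        obtain ⟨T, a, b, h1, h2⟩ := h.cover x y hxy hadj
        exact hcon ⟨T, _, _, _, _, h1, h2⟩)
    exact h.not_path a b hab
  obtain ⟨e, f, hef⟩ := hS.path
  obtain ⟨c, d, hcd⟩ := hS.path_compl
  obtain ⟨hnef, hadjef⟩ := hS.ends h.conn hef
  obtain ⟨hdege, hdegd⟩ := h.degree_ends hS hef hcd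
  have hdegf := (h.degree_ends hS hef.symm hcd).1
  have hd : d ∉ S := hcd.end_mem
  -- coordinates: `d` is `0`, the path on `S` is `1, …, p`
  obtain ⟨p, u, hp, huinj, huS, hu1, hup, huadj⟩ := hef.enumerate
  set v : ℕ → V := fun i => if i = 0 then d else u i with hv
  have v0 : v 0 = d := rfl
  have vpos : ∀ i, 1 ≤ i → v i = u i := fun i hi => by simp [hv, show i ≠ 0 by omega]
  have v1 : v 1 = e := by rw [vpos 1 le_rfl, hu1]
  have vp : v p = f := by rw [vpos p hp, hup]
  have vmem : ∀ i, 1 ≤ i → i ≤ p → v i ∈ S := fun i h1 h2 => by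
    rw [vpos i h1, ← huS]; exact ⟨i, ⟨h1, h2⟩, rfl⟩
  have vimg : v '' Set.Icc 1 p = S := by
    rw [← huS]
    exact Set.image_congr fun i hi => vpos i hi.1
  have vinj : Set.InjOn v (Set.Icc 0 p) := by
    intro i hi j hj hij
    rcases Nat.eq_zero_or_pos i with rfl | hi0 <;> rcases Nat.eq_zero_or_pos j with rfl | hj0
    · rfl
    · exact absurd (by rw [← v0, hij]; exact vmem j hj0 hj.2) hd
    · exact absurd (by rw [← v0, ← hij]; exact vmem i hi0 hi.2) hd
    · rw [vpos i hi0, vpos j hj0] at hij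
      exact huinj ⟨hi0, hi.2⟩ ⟨hj0, hj.2⟩ hij
  have vinj1 : Set.InjOn v (Finset.Icc 1 p) :=
    vinj.mono fun i hi => by simp at hi ⊢; omega
  have vimg0 : v '' Set.Icc 0 p = insert d S := by
    have : Set.Icc 0 p = insert 0 (Set.Icc 1 p) := by ext x; simp; omega
    rw [this, Set.image_insert_eq, v0, vimg]
  have hp1 : p ≠ 1 := by rintro rfl; exact hnef (v1.symm.trans vp)
  set K := G.comap v with hK
  have hKadj : ∀ {i j}, K.Adj i j ↔ G.Adj (v i) (v j) := Iff.rfl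
  have hNI : NonInsPath K p := by
    refine ⟨fun i h1 h2 => ?_, fun a b hab => ?_⟩
    · rw [hKadj, vpos i h1, vpos (i + 1) (by omega)]
      exact huadj i h1 h2
    · have := hab.of_comap vinj
      rw [vimg0] at this
      exact hS.not_path_of_ssubset (Set.ssubset_insert hd)
        (h.path_or_empty hS (Set.subset_insert _ _)) _ _ this
  have hsegv : ∀ {i j}, 1 ≤ i → i ≤ j → j ≤ p → PathOn G (v '' Set.Icc i j) (v i) (v j) :=
    fun {i j} h1 h2 h3 => (hNI.seg h1 h2 h3).of_comap (vinj.mono (Set.Icc_subset_Icc (by omega) h3))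
  have hdisj : ∀ {X Y : Set ℕ}, X ⊆ Set.Icc 0 p → Y ⊆ Set.Icc 0 p → Disjoint X Y →
      Disjoint (v '' X) (v '' Y) := by
    intro X Y hX hY hXY
    rw [Set.disjoint_left]
    rintro _ ⟨i, hi, rfl⟩ ⟨j, hj, hij⟩
    exact Set.disjoint_left.1 hXY hi (vinj (hY hj) (hX hi) hij ▸ hj)
  -- degrees in these coordinates
  have cinS : ∀ x : V, ((Finset.Icc 1 p).filter (fun i => G.Adj x (v i))).card =
      (Finset.univ.filter (fun y => G.Adj x y ∧ y ∈ S)).card := by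
    intro x
    refine Finset.card_bij (fun i _ => v i) ?_ ?_ ?_
    · intro i hi
      simp only [Finset.mem_filter, Finset.mem_Icc, Finset.mem_univ, true_and] at hi ⊢
      exact ⟨hi.2, vmem i hi.1.1 hi.1.2⟩
    · intro i hi j hj hij
      exact vinj1 (Finset.mem_filter.1 hi).1 (Finset.mem_filter.1 hj).1 hij
    · intro y hy
      simp only [Finset.mem_filter, Finset.mem_univ, true_and] at hy
      obtain ⟨hy1, hy2⟩ := hy
      rw [← vimg] at hy2
      obtain ⟨i, hi, rfl⟩ := hy2
      exact ⟨i, by simpa [hy1] using hi, rfl⟩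
  have cdeg : ∀ x : V, G.degree x = (Finset.univ.filter (fun y => G.Adj x y ∧ y ∈ S)).card +
      (Finset.univ.filter (fun y => G.Adj x y ∧ y ∉ S)).card := by
    intro x
    rw [← Finset.filter_filter, ← Finset.filter_filter, Finset.card_filter_add_card_filter_not,
      ← G.card_neighborFinset_eq_degree, G.neighborFinset_eq_filter]
  have cend : ∀ {x y}, PathOn G S x y →
      ((Finset.Icc 1 p).filter (fun i => G.Adj x (v i))).card = G.degree x := by
    intro x y hxy
    rw [cinS, cdeg, Finset.filter_false_of_mem (p := fun y => G.Adj x y ∧ y ∉ S)]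
    · simp
    · exact fun z _ hz => hS.not_adj_of_end hxy hz.2 hz.1
  have cA : ((Finset.Icc 1 p).filter (K.Adj 1)).card = G.degree e := by
    rw [← cend hef]
    simp only [hKadj, v1]
  have cAp : ((Finset.Icc 1 p).filter (K.Adj p)).card = G.degree f := by
    rw [← cend hef.symm]
    simp only [hKadj, vp]
  set R : Finset V := Finset.univ.filter (· ∉ S) with hR
  have memR : ∀ {x}, x ∈ R ↔ x ∉ S := by simp [hR]
  have hdR : d ∈ R := memR.2 hd
  have hRpos : 1 ≤ R.card := Finset.card_pos.2 ⟨d, hdR⟩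
  have cB : ((Finset.Icc 1 p).filter (K.Adj 0)).card + R.card = G.degree d + 1 := by
    have h1 : ((Finset.Icc 1 p).filter (K.Adj 0)).card =
        ((Finset.Icc 1 p).filter (fun i => G.Adj d (v i))).card := by simp only [hKadj, v0]
    have h2 : Finset.univ.filter (fun y => G.Adj d y ∧ y ∉ S) = R.erase d := by
      ext y
      simp only [Finset.mem_filter, Finset.mem_univ, true_and, Finset.mem_erase, memR]
      exact ⟨fun hy => ⟨hy.1.ne', hy.2⟩, fun hy => ⟨h.adj_compl hS hd hy.2 hy.1.symm, hy.2⟩⟩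
    rw [h1, cinS, cdeg d, h2, Finset.card_erase_of_mem hdR]
    omega
  have cSR : p + R.card = Fintype.card V := by
    have h1 : (Finset.univ.filter (· ∈ S)).card = p := by
      have : Finset.univ.filter (· ∈ S) = (Finset.Icc 1 p).image v := by
        ext x
        rw [Finset.mem_filter, ← vimg]
        simp
      rw [this, Finset.card_image_of_injOn vinj1]
      simp
    have := Finset.card_filter_add_card_filter_not (s := (Finset.univ : Finset V)) (· ∈ S)
    rw [h1] at this
    exact this
  -- the complement of `S` is small
  have hRs : R.card ≤ s := by
    -- `E` consists of the `s + t - 3` starts of rotated paths on `S`, all ending in `f`. With `f`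
    -- added it sees nothing of `R` and, if `s ≥ 2`, has at least `t` elements.
    set E := ((Finset.Icc 1 p).filter (K.Adj 1)).image (fun i => v (i - 1)) with hE
    have pred : ∀ i ∈ (Finset.Icc 1 p).filter (K.Adj 1), 1 < i ∧ i ≤ p ∧ K.Adj 1 i := by
      intro i hi
      simp only [Finset.mem_filter, Finset.mem_Icc] at hi
      have : i ≠ 1 := by rintro rfl; exact K.loopless.irrefl _ hi.2
      exact ⟨by omega, by omega, hi.2⟩
    have cE : E.card = G.degree e := by
      rw [← cA]
      refine Finset.card_image_of_injOn fun i hi j hj hij => ?_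
      have h1 := pred i hi
      have h2 := pred j hj
      have := vinj (show i - 1 ∈ Set.Icc 0 p by simp; omega)
        (show j - 1 ∈ Set.Icc 0 p by simp; omega) hij
      omega
    have hEf : ∀ x ∈ E, PathOn G S x f := by
      intro x hx
      obtain ⟨i, hi, rfl⟩ := Finset.mem_image.1 hx
      obtain ⟨h1, h2, h3⟩ := pred i hi
      refine (vp ▸ (hsegv (j := i - 1) le_rfl (by omega) (by omega)).symm.append (hKadj.1 h3)
        (hsegv (by omega) h2 le_rfl) (hdisj ?_ ?_ ?_)).of_eq ?_
      · intro x hx; simp at hx ⊢; omega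
      · intro x hx; simp at hx ⊢; omega
      · rw [Set.disjoint_left]; simp; omega
      · rw [← Set.image_union, ← vimg]
        congr 1
        ext x; simp; omega
    have hfE : f ∉ E := fun hf => (hS.ends h.conn (hEf f hf)).1 rfl
    rcases h.s_pos.lt_or_eq with hs | hs
    · have := h.hole.symm (insert f E) R (Finset.subset_univ _) (Finset.subset_univ _) ?_ ?_ ?_
      · omega
      · rw [Finset.disjoint_left]
        intro x hx hxR
        refine memR.1 hxR ?_
        rcases Finset.mem_insert.1 hx with rfl | hx
        exacts [hef.end_mem, (hEf x hx).start_mem]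
      · intro x hx y hy
        rcases Finset.mem_insert.1 hx with rfl | hx
        exacts [hS.not_adj_of_end hef.symm (memR.1 hy), hS.not_adj_of_end (hEf x hx) (memR.1 hy)]
      · rw [Finset.card_insert_of_notMem hfE]; omega
    -- For `s = 1` the set `E` with `f` has only `t - 1` elements; here `f` alone is set against `E
    -- ∪ R`.
    · have := h.hole {f} (E ∪ R) (Finset.subset_univ _) (Finset.subset_univ _) ?_ ?_ ?_
      · rw [Finset.card_union_of_disjoint] at this
        · omega
        · rw [Finset.disjoint_left]
          exact fun x hx hxR => memR.1 hxR (hEf x hx).start_mem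
      · rw [Finset.disjoint_singleton_left, Finset.mem_union, not_or]
        exact ⟨hfE, fun hfR => memR.1 hfR hef.end_mem⟩
      · intro x hx y hy
        rw [Finset.mem_singleton] at hx
        subst hx
        rcases Finset.mem_union.1 hy with hy | hy
        · exact fun e => (hS.ends h.conn (hEf y hy)).2 e.symm
        · exact hS.not_adj_of_end hef.symm (memR.1 hy)
      · simp [← hs]
  -- successors of neighbours of `d` form an independent set which sees nothing outside `S`
  set J := (Finset.Icc 1 p).filter (fun j => j = 1 ∨ K.Adj 0 (j - 1)) with hJ
  have memJ : ∀ {j}, j ∈ J ↔ (1 ≤ j ∧ j ≤ p) ∧ (j = 1 ∨ K.Adj 0 (j - 1)) := by simp [hJ]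
  have hJc := card_succ_filter hp (hNI.not_adj_last hp)
  rw [← hJ] at hJc
  have hJinj : Set.InjOn v J := vinj1.mono fun j hj => (Finset.mem_filter.1 hj).1
  have hJind : ∀ x ∈ J.image v, ∀ y ∈ J.image v, ¬ G.Adj x y := by
    intro x hx y hy
    obtain ⟨i, hi, rfl⟩ := Finset.mem_image.1 hx
    obtain ⟨j, hj, rfl⟩ := Finset.mem_image.1 hy
    rw [memJ] at hi hj
    rcases lt_trichotomy i j with hij | rfl | hij
    · exact hNI.not_adj_of_succ hi.1.1 hij hj.1.2 hi.2 hj.2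
    · exact SimpleGraph.irrefl _
    · exact fun e => hNI.not_adj_of_succ hj.1.1 hij hi.1.2 hj.2 hi.2 e.symm
  have hJR : ∀ x ∈ J.image v, ∀ y ∈ R, ¬ G.Adj x y := by
    intro x hx y hy hadj
    obtain ⟨j, hj, rfl⟩ := Finset.mem_image.1 hx
    rw [memJ] at hj
    by_cases hj1 : j = 1
    · subst hj1
      rw [v1] at hadj
      exact hS.not_adj_of_end hef (memR.1 hy) hadj
    have hjadj := hj.2.resolve_left hj1
    by_cases hyd : y = d
    · subst hyd
      have := hNI.not_adj_consecutive (i := j - 1) (by omega) (by omega) hjadj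
      rw [show j - 1 + 1 = j by omega] at this
      exact this hadj.symm
    · have hySS : y ∉ S := memR.1 hy
      -- A detour `j-1, d, y, j` through the clique outside `S` would lengthen the path on `S`.
      have hpath : PathOn G (insert y (insert d S)) (v 1) (v p) := by
        refine ((((hsegv (j := j - 1) le_rfl (by omega) (by omega)).append hjadj.symm
          (PathOn.single d) ?_).append (h.adj_compl hS hd hySS (Ne.symm hyd))
          (PathOn.single y) ?_).append hadj.symm (hsegv hj.1.1 hj.1.2 le_rfl) ?_).of_eq ?_
        · rw [Set.disjoint_singleton_right]
          exact fun hdm => hd (vimg ▸ Set.image_mono (Set.Icc_subset_Icc le_rfl (by omega)) hdm)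
        · rw [Set.disjoint_singleton_right]
          rintro (hym | hym)
          · exact hySS (vimg ▸ Set.image_mono (Set.Icc_subset_Icc le_rfl (by omega)) hym)
          · exact hyd hym
        · have hsub : v '' Set.Icc j p ⊆ S :=
            vimg ▸ Set.image_mono (Set.Icc_subset_Icc hj.1.1 le_rfl)
          rw [Set.disjoint_union_left, Set.disjoint_union_left, Set.disjoint_singleton_left,
            Set.disjoint_singleton_left]
          refine ⟨⟨hdisj ?_ ?_ ?_, fun hm => hd (hsub hm)⟩, fun hm => hySS (hsub hm)⟩
          · intro x hx; simp at hx ⊢; omega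
          · intro x hx; simp at hx ⊢; omega
          · rw [Set.disjoint_left]; simp; omega
        · have : S = v '' Set.Icc 1 (j - 1) ∪ v '' Set.Icc j p := by
            rw [← vimg, ← Set.image_union]
            congr 1
            ext x; simp; omega
          rw [this]
          ext x; simp [or_assoc]
      have hsub : S ⊆ insert y (insert d S) := fun x hx => Or.inr (Or.inr hx)
      exact hS.not_path_of_ssubset ((Set.ssubset_iff_of_subset hsub).2 ⟨y, Or.inl rfl, hySS⟩)
        (h.path_or_empty hS hsub) _ _ hpath
  have hJS : ∀ x ∈ J.image v, x ∈ S := by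
    intro x hx
    obtain ⟨j, hj, rfl⟩ := Finset.mem_image.1 hx
    rw [memJ] at hj
    exact vmem j hj.1.1 hj.1.2
  have hJic : (J.image v).card = J.card := Finset.card_image_of_injOn hJinj
  -- the complement of `S` is a single vertex
  have hR1 : R.card = 1 := by
    by_contra hRne
    -- If `f` follows a neighbour of `d`, the path without `f` continues through all of the
    -- complement and leaves only `{f}`; maximality then forces `|R| ≤ 1`.
    have hpJ : f ∉ J.image v := by
      intro hf
      obtain ⟨j, hj, hjf⟩ := Finset.mem_image.1 hf
      rw [memJ] at hj
      obtain rfl : j = p := vinj ⟨by omega, hj.1.2⟩ ⟨by omega, le_rfl⟩ (hjf.trans vp.symm)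
      have hadj := hj.2.resolve_left hp1
      have hpath := (hsegv (j := j - 1) le_rfl (by omega) (by omega)).append hadj.symm
        hcd.symm (disjoint_compl_right.mono_left
          (vimg ▸ Set.image_mono (Set.Icc_subset_Icc le_rfl (by omega))))
      have hT : (v '' Set.Icc 1 (j - 1) ∪ Sᶜ)ᶜ = {f} := by
        ext x
        simp only [Set.mem_compl_iff, Set.mem_union, not_or, not_not, Set.mem_singleton_iff]
        constructor
        · rintro ⟨hx1, hx2⟩
          rw [← vimg] at hx2
          obtain ⟨i, hi, rfl⟩ := hx2
          have : i = j := by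
            by_contra hne
            exact hx1 ⟨i, ⟨hi.1, by have := hi.2; omega⟩, rfl⟩
          rw [this, vp]
        · rintro rfl
          refine ⟨?_, hef.end_mem⟩
          rintro ⟨i, hi, hie⟩
          have := vinj ⟨by omega, by have := hi.2; omega⟩ ⟨by omega, le_rfl⟩ (hie.trans vp.symm)
          have := hi.2
          omega
      have hle := hS.le _ _ _ f f hpath (hT ▸ PathOn.single f)
      have c1 := Set.ncard_add_ncard_compl (v '' Set.Icc 1 (j - 1) ∪ Sᶜ)
      have c2 := Set.ncard_add_ncard_compl S
      have c3 : Sᶜ.ncard = R.card := by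
        rw [← Set.ncard_coe_finset]
        congr 1
        ext x; simp [hR]
      rw [hT, Set.ncard_singleton] at c1
      omega
    -- Since `|J| + |R| + 1 = s + t`, the vertex `f` has `t ≥ 2` neighbours in the image of `J`, but
    -- it can have only one.
    have := h.hole.le_card_filter_adj (J := J.image v) (P := R) (w := f) (Finset.subset_univ _)
      (Finset.subset_univ _) (Finset.mem_univ _) hJind hpJ (fun hf => memR.1 hf hef.end_mem)
      (Finset.disjoint_left.2 fun x hx hxR => memR.1 hxR (hJS x hx))
      (fun x hx => hS.not_adj_of_end hef.symm (memR.1 hx)) hJR (by omega) hRs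
    obtain ⟨x, hx, y, hy, hxy⟩ := Finset.one_lt_card.1 (lt_of_lt_of_le (show 1 < t by omega) this)
    obtain ⟨hx1, hx2⟩ := Finset.mem_filter.1 hx
    obtain ⟨hy1, hy2⟩ := Finset.mem_filter.1 hy
    obtain ⟨i, hi, rfl⟩ := Finset.mem_image.1 hx1
    obtain ⟨j, hj, rfl⟩ := Finset.mem_image.1 hy1
    rw [memJ] at hi hj
    rw [← vp] at hx2 hy2
    rcases lt_trichotomy i j with hij | rfl | hij
    · exact hNI.not_adj_last_of_succ hi.1.1 hij hj.1.2 hi.2 hj.2 hx2.symm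
    · exact hxy rfl
    · exact hNI.not_adj_last_of_succ hj.1.1 hij hi.1.2 hj.2 hi.2 hy2.symm
  have hconf : InsConf K p s t :=
    { toNonInsPath := hNI
      one_le := hp
      hole := h.hole.comap (fun _ _ => by simp) (by simpa using vinj)
      not_adj_ends := by rw [hKadj, v1, vp]; exact hadjef
      deg_one := by omega
      deg_last := by omega
      card_eq := by omega
      s_pos := h.s_pos
      s_le := h.s_le
      two_le := h.two_le }
  have hlen := hconf.length_eq
  have hdJ : d ∉ J.image v := fun hdJ => hd (hJS d hdJ)
  refine ⟨insert d (J.image v), ?_, ?_, ?_⟩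
  · intro x hx y hy
    rcases Finset.mem_insert.1 hx with rfl | hx <;> rcases Finset.mem_insert.1 hy with rfl | hy
    · exact SimpleGraph.irrefl _
    · exact fun e => hJR y hy x hdR e.symm
    · exact hJR x hx y hdR
    · exact hJind x hx y hy
  · rw [Finset.card_insert_of_notMem hdJ]; omega
  · rw [Finset.card_insert_of_notMem hdJ]; omega

end Counterexample
end

end BipartiteHole

/-! ### Reduction to an edge-maximal graph, and the exceptional joins. -/

namespace BipartiteHole

variable {V : Type*}

theorem HasBipartiteHole.symm {G : SimpleGraph V} {s t : ℕ} (h : HasBipartiteHole G s t) :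
    HasBipartiteHole G t s := by
  obtain ⟨S, T, hd, hS, hT, hn⟩ := h
  exact ⟨T, S, hd.symm, hT, hS, fun x hx y hy e => hn y hy x hx e.symm⟩

theorem holeFreeOn_of_not_hasBipartiteHole {G : SimpleGraph V} {s t : ℕ}
    (h : ¬ HasBipartiteHole G s t) (U : Finset V) : HoleFreeOn G U s t := by
  intro X Y _ _ hd hn hX
  by_contra hY
  obtain ⟨X', hX', hXc⟩ := Finset.exists_subset_card_eq hX
  obtain ⟨Y', hY', hYc⟩ := Finset.exists_subset_card_eq (not_lt.1 hY)
  exact h ⟨X', Y', Finset.disjoint_of_subset_left hX' (Finset.disjoint_of_subset_right hY' hd),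
    hXc, hYc, fun x hx y hy => hn x (hX' hx) y (hY' hy)⟩

theorem HoleFreeOn.mono {G H : SimpleGraph V} (hGH : G ≤ H) {U : Finset V} {s t : ℕ}
    (h : HoleFreeOn G U s t) : HoleFreeOn H U s t :=
  fun X Y hX hY hd hn => h X Y hX hY hd fun x hx y hy e => hn x hx y hy (hGH e)

theorem exists_not_hasBipartiteHole [Fintype V] (G : SimpleGraph V) :
    ∃ s t, 1 ≤ s ∧ s ≤ t ∧ s + t = bipartiteHoleNumber G + 1 ∧ ¬ HasBipartiteHole G s t := by
  obtain ⟨s, t, hs, ht, hst, hn⟩ := Nat.sInf_mem (bipartiteHoleNumber_set_nonempty G)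
  change s + t = bipartiteHoleNumber G + 1 at hst
  rcases le_total s t with h | h
  · exact ⟨s, t, hs, h, hst, hn⟩
  · exact ⟨t, s, ht, h, by omega, fun h' => hn h'.symm⟩

theorem sigmaTwo_le [Fintype V] {G : SimpleGraph V} [DecidableRel G.Adj] {x y : V} (hxy : x ≠ y)
    (hadj : ¬ G.Adj x y) : sigmaTwo G ≤ ((G.degree x + G.degree y : ℕ) : ℕ∞) :=
  iInf_le_of_le x (iInf_le_of_le y (iInf_le_of_le hxy (iInf_le_of_le hadj le_rfl)))

theorem exists_indep_of_not_path [Fintype V] {G : SimpleGraph V} [DecidableRel G.Adj]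
    (hconn : G.Connected) (hG : ∀ a b, ¬ PathOn G Set.univ a b)
    (hdeg : ∀ x y, x ≠ y → ¬ G.Adj x y →
      2 * bipartiteHoleNumber G ≤ G.degree x + G.degree y + 4) :
    ∃ I : Finset V, (∀ x ∈ I, ∀ y ∈ I, ¬ G.Adj x y) ∧ I.card = bipartiteHoleNumber G ∧
      2 * I.card = Fintype.card V + 2 := by
  classical
  obtain ⟨s, t, hs, hst, hk, hn⟩ := exists_not_hasBipartiteHole G
  obtain ⟨M, hGM, hM, hmax⟩ := Finite.exists_le_maximal
    (p := fun H : SimpleGraph V => ∀ a b, ¬ PathOn H Set.univ a b) hG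
  have hhole := (holeFreeOn_of_not_hasBipartiteHole hn Finset.univ).mono hGM
  have hcover : ∀ x y, x ≠ y → ¬ M.Adj x y →
      ∃ T a b, PathOn M T x a ∧ PathOn M Tᶜ b y := by
    intro x y hxy hadj
    by_contra hcon
    have hnew : ¬ M ⊔ SimpleGraph.edge x y ≤ M := fun hle =>
      hadj (hle (Or.inr (by simp [SimpleGraph.edge_adj, hxy])))
    refine hnew (hmax (y := M ⊔ SimpleGraph.edge x y) (fun a b hab => ?_) le_sup_left)
    rcases hab.of_sup_edge with h | ⟨S₁, S₂, hd, hu, h⟩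
    · exact hM a b h
    · have hc : S₁ᶜ = S₂ := (IsCompl.of_eq hd.inter_eq hu).compl_eq
      rcases h with ⟨h1, h2⟩ | ⟨h1, h2⟩
      · exact hcon ⟨S₁, a, b, h1.symm, hc ▸ h2.symm⟩
      · refine hcon ⟨S₂, b, a, h2, ?_⟩
        rw [← hc, compl_compl]
        exact h1
  -- With `s = t = 1` there is no non-adjacent pair, so the graph is complete and has a Hamilton
  -- path.
  have ht : 2 ≤ t := by
    by_contra hlt
    have := hconn.nonempty
    obtain ⟨a, b, hab⟩ := PathOn.exists_of_clique (G := M) (Set.toFinite Set.univ)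
      Set.univ_nonempty (fun x _ y _ hxy => by
        by_contra hadj
        have := hhole {x} {y} (Finset.subset_univ _) (Finset.subset_univ _) (by simpa using hxy)
          (by simpa using hadj) (by simp; omega)
        simp at this
        omega)
    exact hM a b hab
  have hce : Counterexample M s t :=
    { conn := hconn.mono hGM
      not_path := hM
      cover := hcover
      hole := hhole
      s_pos := hs
      s_le := hst
      two_le := ht
      deg := by
        intro x y hxy hadj
        have h1 := hdeg x y hxy fun e => hadj (hGM e)
        have h2 := SimpleGraph.degree_le_of_le (v := x) hGM
        have h3 := SimpleGraph.degree_le_of_le (v := y) hGM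
        omega }
  obtain ⟨I, hI, hIc, hIn⟩ := hce.exists_indep
  exact ⟨I, fun x hx y hy e => hI x hx y hy (hGM e), by omega, hIn⟩

/-- A graph in which an independent set is completely joined to its complement is a join. -/
theorem exists_iso_join [Fintype V] {G : SimpleGraph V} {I : Finset V} {a b : ℕ}
    (hb : I.card = b) (hab : Fintype.card V = a + b) (hI : ∀ x ∈ I, ∀ y ∈ I, ¬ G.Adj x y)
    (hIc : ∀ x ∈ I, ∀ y ∉ I, G.Adj x y) :
    ∃ H : SimpleGraph (Fin a), Nonempty (G ≃g join H (⊥ : SimpleGraph (Fin b))) := by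
  classical
  have e₁ : Fin b ≃ {x // x ∈ I} := (Fintype.equivFinOfCardEq (by simpa using hb)).symm
  have e₂ : Fin a ≃ {x // x ∉ I} := (Fintype.equivFinOfCardEq (by
    rw [Fintype.card_subtype_compl, Fintype.card_coe]; omega)).symm
  set ψ : Fin a ⊕ Fin b ≃ V :=
    (e₂.sumCongr e₁).trans ((Equiv.sumComm _ _).trans (Equiv.sumCompl (· ∈ I)))
  have hl : ∀ i, ψ (Sum.inl i) = (e₂ i : V) := fun i => rfl
  have hr : ∀ i, ψ (Sum.inr i) = (e₁ i : V) := fun i => rfl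
  let φ : join (G.comap fun i => (e₂ i : V)) (⊥ : SimpleGraph (Fin b)) ≃g G :=
    ⟨ψ, by
      rintro (i | i) (j | j)
      · simp [join, hl]
      · simpa [join, hl, hr] using (hIc _ (e₁ j).2 _ (e₂ i).2).symm
      · simpa [join, hl, hr] using hIc _ (e₁ i).2 _ (e₂ j).2
      · simpa [join, hr] using hI _ (e₁ i).2 _ (e₁ j).2⟩
  exact ⟨_, ⟨φ.symm⟩⟩

/-- A Hamilton path allows an independent set at most `(n + 1) / 2` vertices, and here one has at
least `(n + 2) / 2`. -/
theorem not_path_of_iso_join [Fintype V] {G : SimpleGraph V} {a b : ℕ} {H : SimpleGraph (Fin a)}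
    (φ : G ≃g join H (⊥ : SimpleGraph (Fin b))) (hab : Fintype.card V + 2 ≤ 2 * b) (x y : V) :
    ¬ PathOn G Set.univ x y := by
  intro h
  have hI := (h.two_mul_ncard_indep_le (I := Set.range fun i => φ.symm (Sum.inr i)) ?_).1
  · have hinj : Function.Injective fun i : Fin b => φ.symm (Sum.inr i) :=
      φ.symm.injective.comp Sum.inr_injective
    rw [Set.univ_inter, Set.ncard_univ, Nat.card_eq_fintype_card, ← Set.image_univ,
      Set.ncard_image_of_injective _ hinj, Set.ncard_univ,
      Nat.card_fin] at hI
    omega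
  · rintro _ ⟨i, rfl⟩ _ ⟨j, rfl⟩
    rw [φ.symm.map_adj_iff]
    simp [join]

end BipartiteHole

/-- A connected graph `G` of order `n` with `σ₂(G) ≥ 2 α̃(G) - 4` is traceable, unless `n ≥ 4` is
even and `G` is the join of some graph of order `(n-2)/2` with `(n+2)/2` isolated vertices
(and in that exceptional case it is not traceable). -/
theorem mainTheorem3 {V : Type*} [Fintype V] [DecidableEq V] (G : SimpleGraph V)
    [DecidableRel G.Adj] (hconn : G.Connected)
    (hσ : 2 * (BipartiteHole.bipartiteHoleNumber G : ℕ∞) ≤ BipartiteHole.sigmaTwo G + 4) :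
    BipartiteHole.IsTraceable G ↔
      ¬ (4 ≤ Fintype.card V ∧ Even (Fintype.card V) ∧
        ∃ H : SimpleGraph (Fin ((Fintype.card V - 2) / 2)),
          Nonempty (G ≃g BipartiteHole.join H
            (⊥ : SimpleGraph (Fin ((Fintype.card V + 2) / 2))))) := by
  rw [BipartiteHole.isTraceable_iff]
  constructor
  · rintro ⟨a, b, hab⟩ ⟨-, ⟨m, hm⟩, H, ⟨φ⟩⟩
    exact BipartiteHole.not_path_of_iso_join φ (by omega) a b hab
  · intro hex
    by_contra hnt
    push Not at hnt
    have hdeg : ∀ x y, x ≠ y → ¬ G.Adj x y →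
        2 * BipartiteHole.bipartiteHoleNumber G ≤ G.degree x + G.degree y + 4 := by
      intro x y hxy hadj
      have := hσ.trans (add_le_add_left (BipartiteHole.sigmaTwo_le hxy hadj) 4)
      exact_mod_cast this
    obtain ⟨I, hI, hIk, hIn⟩ := BipartiteHole.exists_indep_of_not_path hconn hnt hdeg
    have hpos : 0 < Fintype.card V := Fintype.card_pos_iff.2 hconn.nonempty
    have hsub : ∀ x ∈ I, G.neighborFinset x ⊆ Iᶜ := by
      intro x hx y hy
      rw [Finset.mem_compl]
      exact fun hyI => hI x hx y hyI ((G.mem_neighborFinset x y).1 hy)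
    have hcI := Finset.card_compl I
    have hle : ∀ x ∈ I, G.degree x + 2 ≤ I.card := by
      intro x hx
      have := Finset.card_le_card (hsub x hx)
      rw [G.card_neighborFinset_eq_degree] at this
      omega
    -- Two vertices of `I` have degree sum at least `2|I| - 4` and each has degree at most `|I| - 2
    -- = n - |I|`, so each sees all of the complement of `I`.
    have hIc : ∀ x ∈ I, ∀ y ∉ I, G.Adj x y := by
      intro x hx y hy
      obtain ⟨z, hz, hzx⟩ := Finset.exists_mem_ne (show 1 < I.card by omega) x
      have h1 := hdeg x z hzx.symm (hI x hx z hz)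
      have h2 := hle x hx
      have h3 := hle z hz
      have := Finset.eq_of_subset_of_card_le (hsub x hx)
        (by rw [G.card_neighborFinset_eq_degree]; omega)
      rw [← G.mem_neighborFinset, this, Finset.mem_compl]
      exact hy
    -- For `n = 2` the set `I` would be everything, against connectedness.
    have hn : Fintype.card V ≠ 2 := by
      intro hn
      have hIu : I = Finset.univ := Finset.eq_univ_of_card I (by omega)
      obtain ⟨x, hx⟩ := Finset.card_pos.1 (show 0 < I.card by omega)
      obtain ⟨z, hz, hzx⟩ := Finset.exists_mem_ne (show 1 < I.card by omega) x
      obtain ⟨u, -, w, -, huw⟩ := BipartiteHole.exists_adj_boundary hconn (S := {x}) ⟨x, rfl⟩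
        ⟨z, hzx⟩
      exact hI u (by simp [hIu]) w (by simp [hIu]) huw
    exact hex ⟨by omega, ⟨I.card - 1, by omega⟩,
      BipartiteHole.exists_iso_join (by omega) (by omega) hI hIc⟩
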